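/- Let $\alpha\in(0,1)$, $N\in\mathbb N$ with $N>2\alpha$, and $2^*_\alpha:=\frac{2N}{N-2\alpha}$. Let $\mathcal D^{\alpha,2}(\mathbb R^N)$ be the completion of $C_c^\infty(\mathbb R^N)$ with respect to $$[u]:=\Big(\iint_{\mathbb R^{2N}}\frac{|u(x)-u(y)|^2}{|x-y|^{N+2\alpha}}\,dx\,dy\Big)^{1/2},$$ regarded as a space of functions modulo equality almost everywhere. Let $V,K:\mathbb R^N\to\mathbb R$ be continuous and positive, with $K\in L^\infty(\mathbb R^N)$, such that for every $R>0$ and every sequence $(A_n)$ of Borel sets of Lebesgue measure at most $R$, $\int_{A_n\setminus B_r(0)}K\,dx\to0$ as $r\to+\infty$, uniformly in $n$. Let $f:\mathbb R\to\mathbb R$ be continuous, put $F(t):=\int_0^tf(\tau)\,d\tau$, and suppose that at least one of the following holds: (A) $K/V\in L^\infty(\mathbb R^N)$ and $\lim_{t\to0}\frac{f(t)}{|t|}=0$; (B) for some $m\in(2,2^*_\alpha)$, $K(x)/V(x)^{\frac{2^*_\alpha-m}{2^*_\alpha-2}}\to0$ as $|x|\to+\infty$ and $\limsup_{t\to0}\frac{|f(t)|}{|t|^{m-1}}<+\infty$.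 Suppose also that $$\lim_{|t|\to\infty}\frac{f(t)}{|t|^{2^*_\alpha-1}}=0,\qquad \lim_{|t|\to\infty}\frac{F(t)}{|t|^2}=+\infty,$$ and that $t\mapsto f(t)/|t|$ is strictly increasing on $\mathbb R\setminus\{0\}$. Let $X:=\{u\in\mathcal D^{\alpha,2}(\mathbb R^N):\int_{\mathbb R^N} V|u|^2\,dx<\infty\}$, with $\|u\|:=\big([u]^2+\int_{\mathbb R^N} V|u|^2\,dx\big)^{1/2}$. For $u,\varphi\in X$ let $$J(u):=\tfrac12\|u\|^2-\int_{\mathbb R^N}K\,F(u)\,dx,$$ $$\langle J'(u),\varphi\rangle:=\iint_{\mathbb R^{2N}}\frac{(u(x)-u(y))(\varphi(x)-\varphi(y))}{|x-y|^{N+2\alpha}}\,dx\,dy+\int_{\mathbb R^N}Vu\varphi\,dx-\int_{\mathbb R^N}Kf(u)\varphi\,dx.$$ Write $u^+:=\max\{u,0\}$ and $u^-:=\min\{u,0\}$, and let $$\mathcal M:=\{w\in X\setminus\{0\}: w^+\ne0,\ w^-\neq0,\ \langle J'(w),w\rangle=\langle J'(w),w^+\rangle=\langle J'(w),w^-\rangle=0\}.$$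 Let $u\in X$ with $u^+\neq0$ and $u^-\ne0$, and for $t,s\ge0$ let $$h^u(t,s):=J(tu^++su^-),\qquad \Phi^u_1(t,s):=\langle J'(tu^++su^-),u^+\rangle,\qquad \Phi_2^u(t,s):=\langle J'(tu^++su^-),u^-\rangle.$$ Then $h^u$ is differentiable on $[0,\infty)\times[0,\infty)$ (relative to this set) with gradient $(\Phi^u_1,\Phi^u_2)$, and: (i) For $t,s\ge0$: $(t,s)$ is a critical point of $h^u$ with $t,s>0$ if and only if $tu^++su^-\in\mathcal M$. (ii) $h^u$ has exactly one critical point $(t_+,s_-)$ with $t_+>0$ and $s_->0$, and this point is the unique global maximum point of $h^u$ on $[0,\infty)\times[0,\infty)$. (iii) The functions $a_+(r):=\Phi^u_1(r,s_-)\,r$ and $a_-(r):=\Phi_2^u(t_+,r)\,r$ satisfy $a_+(r)>0$ for $0<r<t_+$, $a_+(r)<0$ for $r>t_+$, $a_-(r)>0$ for $0<r<s_-$, and $a_-(r)<0$ for $r>s_-$. -/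

import Mathlib

open MeasureTheory Filter Topology Asymptotics
open scoped ENNReal

namespace FracSchrodinger

/-- The Euclidean space `ℝᴺ`. -/
abbrev Rn (N : ℕ) : Type := EuclideanSpace ℝ (Fin N)

/-- The critical exponent `2N / (N - 2α)`. -/
noncomputable def critExp (α : ℝ) (N : ℕ) : ℝ := 2 * (N : ℝ) / ((N : ℝ) - 2 * α)

/-- The Gagliardo seminorm
`[u] = (∬ |u(x) - u(y)|² / |x - y|^(N + 2α) dx dy)^(1/2)`, with values in `[0, ∞]`. -/
noncomputable def gagliardo {N : ℕ} (α : ℝ) (u : Rn N → ℝ) : ℝ≥0∞ :=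
  (∫⁻ p : Rn N × Rn N,
    ENNReal.ofReal (|u p.1 - u p.2| ^ 2 / ‖p.1 - p.2‖ ^ ((N : ℝ) + 2 * α))) ^ (1 / 2 : ℝ)

/-- The bilinear form `∬ (u(x) - u(y)) (φ(x) - φ(y)) / |x - y|^(N + 2α) dx dy`. -/
noncomputable def gagliardoForm {N : ℕ} (α : ℝ) (u φ : Rn N → ℝ) : ℝ :=
  ∫ p : Rn N × Rn N,
    (u p.1 - u p.2) * (φ p.1 - φ p.2) / ‖p.1 - p.2‖ ^ ((N : ℝ) + 2 * α)

/-- Membership in `D^{α,2}(ℝᴺ)`, the completion of `C_c^∞(ℝᴺ)` for the Gagliardo seminorm,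
realised as a space of functions (modulo a.e. equality): `u` is the limit, in the seminorm and
almost everywhere, of test functions. The almost everywhere convergence fixes the additive
constant, which the seminorm does not see. -/
def MemD {N : ℕ} (α : ℝ) (u : Rn N → ℝ) : Prop :=
  ∃ φ : ℕ → Rn N → ℝ,
    (∀ n, ContDiff ℝ ((⊤ : ℕ∞) : WithTop ℕ∞) (φ n) ∧ HasCompactSupport (φ n)) ∧
    (∀ᵐ x, Tendsto (fun n => φ n x) atTop (𝓝 (u x))) ∧
    Tendsto (fun n => gagliardo α (fun x => φ n x - u x)) atTop (𝓝 0)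

/-- The space `X` of all `u ∈ D^{α,2}(ℝᴺ)` with `∫ V |u|² < ∞`. -/
def spaceX {N : ℕ} (α : ℝ) (V : Rn N → ℝ) : Set (Rn N → ℝ) :=
  {u | MemD α u ∧ Integrable (fun x => V x * |u x| ^ 2)}

/-- The norm of `X`. -/
noncomputable def normX {N : ℕ} (α : ℝ) (V : Rn N → ℝ) (u : Rn N → ℝ) : ℝ :=
  Real.sqrt ((gagliardo α u).toReal ^ 2 + ∫ x, V x * |u x| ^ 2)

/-- Two functions are identified when they agree a.e., so `u ≠ 0` means this. -/
def Nonzero {N : ℕ} (u : Rn N → ℝ) : Prop := ¬ (u =ᵐ[volume] fun _ => (0 : ℝ))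

/-- `u⁺ = max {u, 0}`. -/
noncomputable def pos {N : ℕ} (u : Rn N → ℝ) : Rn N → ℝ := fun x => max (u x) 0

/-- `u⁻ = min {u, 0}` (a nonpositive function, so that `u = u⁺ + u⁻`). -/
noncomputable def neg {N : ℕ} (u : Rn N → ℝ) : Rn N → ℝ := fun x => min (u x) 0

/-- The condition that `K / V` is essentially bounded. -/
def CondH3 {N : ℕ} (V K : Rn N → ℝ) : Prop :=
  MemLp (fun x => K x / V x) ⊤ volume

/-- The condition that `m ∈ (2, 2*)` and `K / V^((2* - m)/(2* - 2)) → 0` at infinity. -/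
def CondH4 {N : ℕ} (α m : ℝ) (V K : Rn N → ℝ) : Prop :=
  2 < m ∧ m < critExp α N ∧
    Tendsto (fun x => K x / V x ^ ((critExp α N - m) / (critExp α N - 2)))
      (cocompact (Rn N)) (𝓝 0)

/-- The class of admissible pairs of potentials. -/
structure ClassK {N : ℕ} (α : ℝ) (V K : Rn N → ℝ) : Prop where
  continuous_V : Continuous V
  continuous_K : Continuous K
  V_pos : ∀ x, 0 < V x
  K_pos : ∀ x, 0 < K x
  K_bounded : MemLp K ⊤ volume
  tail : ∀ (A : ℕ → Set (Rn N)) (R : ℝ), 0 < R → (∀ n, MeasurableSet (A n)) →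
    (∀ n, volume (A n) ≤ ENNReal.ofReal R) →
    TendstoUniformly (fun (r : ℝ) (n : ℕ) => ∫ x in A n ∩ (Metric.ball 0 r)ᶜ, K x)
      (fun _ => 0) atTop
  h3_or_h4 : CondH3 V K ∨ ∃ m, CondH4 α m V K

/-- The primitive `F(t) = ∫₀ᵗ f`. -/
noncomputable def primF (f : ℝ → ℝ) (t : ℝ) : ℝ := ∫ τ in (0 : ℝ)..t, f τ

/-- The assumptions on the nonlinearity `f`, including the behaviour at the origin, which depends
on which of the two alternatives holds for `(V, K)`. -/
structure CondF {N : ℕ} (α : ℝ) (V K : Rn N → ℝ) (f : ℝ → ℝ) : Prop where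
  continuous : Continuous f
  origin :
    (CondH3 V K ∧ Tendsto (fun t => f t / |t|) (𝓝[≠] 0) (𝓝 0)) ∨
    (∃ m, CondH4 α m V K ∧ f =O[𝓝[≠] 0] fun t => |t| ^ (m - 1))
  quasicritical :
    Tendsto (fun t => f t / |t| ^ (critExp α N - 1)) (cocompact ℝ) (𝓝 0)
  superquadratic : Tendsto (fun t => primF f t / |t| ^ 2) (cocompact ℝ) atTop
  increasing : StrictMonoOn (fun t => f t / |t|) {0}ᶜ

/-- The energy functional `J(u) = ‖u‖² / 2 - ∫ K F(u)`. -/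
noncomputable def energy {N : ℕ} (α : ℝ) (V K : Rn N → ℝ) (f : ℝ → ℝ) (u : Rn N → ℝ) : ℝ :=
  1 / 2 * normX α V u ^ 2 - ∫ x, K x * primF f (u x)

/-- The pairing `⟨J'(u), φ⟩`. -/
noncomputable def dEnergy {N : ℕ} (α : ℝ) (V K : Rn N → ℝ) (f : ℝ → ℝ)
    (u φ : Rn N → ℝ) : ℝ :=
  gagliardoForm α u φ + (∫ x, V x * u x * φ x) - ∫ x, K x * f (u x) * φ x

/-- The Nehari manifold. -/
def nehari {N : ℕ} (α : ℝ) (V K : Rn N → ℝ) (f : ℝ → ℝ) : Set (Rn N → ℝ) :=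
  {u | u ∈ spaceX α V ∧ Nonzero u ∧ dEnergy α V K f u u = 0}

/-- The nodal set `M`. -/
def nodal {N : ℕ} (α : ℝ) (V K : Rn N → ℝ) (f : ℝ → ℝ) : Set (Rn N → ℝ) :=
  {w | w ∈ nehari α V K f ∧ Nonzero (pos w) ∧ Nonzero (neg w) ∧
    dEnergy α V K f w (pos w) = 0 ∧ dEnergy α V K f w (neg w) = 0}

/-- The function `t u⁺ + s u⁻`. -/
noncomputable def comb {N : ℕ} (u : Rn N → ℝ) (t s : ℝ) : Rn N → ℝ :=
  fun x => t * pos u x + s * neg u x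

/-- `h^u(t, s) = J(t u⁺ + s u⁻)`; it is studied on the quadrant `[0, ∞) × [0, ∞)`. -/
noncomputable def hFun {N : ℕ} (α : ℝ) (V K : Rn N → ℝ) (f : ℝ → ℝ) (u : Rn N → ℝ)
    (p : ℝ × ℝ) : ℝ :=
  energy α V K f (comb u p.1 p.2)

/-- The closed quadrant `[0, ∞) × [0, ∞)`. -/
def quadrant : Set (ℝ × ℝ) := Set.Ici 0 ×ˢ Set.Ici 0

/-- `p` is a critical point of `h` on the quadrant: `h` is differentiable there with derivative
zero. At points with positive coordinates this is ordinary differentiability. -/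
def IsCritical (h : ℝ × ℝ → ℝ) (p : ℝ × ℝ) : Prop :=
  HasFDerivWithinAt h (0 : ℝ × ℝ →L[ℝ] ℝ) quadrant p

/-- `Φ₁^u(t, s) = ⟨J'(t u⁺ + s u⁻), u⁺⟩`. -/
noncomputable def Phi1 {N : ℕ} (α : ℝ) (V K : Rn N → ℝ) (f : ℝ → ℝ) (u : Rn N → ℝ)
    (t s : ℝ) : ℝ :=
  dEnergy α V K f (comb u t s) (pos u)

/-- `Φ₂^u(t, s) = ⟨J'(t u⁺ + s u⁻), u⁻⟩`. -/
noncomputable def Phi2 {N : ℕ} (α : ℝ) (V K : Rn N → ℝ) (f : ℝ → ℝ) (u : Rn N → ℝ)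
    (t s : ℝ) : ℝ :=
  dEnergy α V K f (comb u t s) (neg u)

end FracSchrodinger

open FracSchrodinger

/-! Since `u⁺` and `u⁻` are never nonzero at the same point, the local terms of `J(t u⁺ + s u⁻)`
split, and only the Gagliardo form couples the two parts. Hence `h^u(t, s) = (a t² + b s²)/2 + c t s
- Ψ₁(t) - Ψ₂(s)`, where `a, b > 0` are the squared `X`-norms of `u⁺, u⁻`, `c` is the Gagliardo form
of the pair, and `Ψ₁(t) = ∫ K F(t u⁺)`, `Ψ₂(s) = ∫ K F(s u⁻)`. A sign computation gives `c ≥ 0`.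

Everything else concerns this function of two variables. Each `Ψ` is `o(t²)` at `0⁺`, so a maximum
cannot lie on the axes. Each grows faster than any quadratic, so a maximum exists. Each `ψ(t)/t`,
with `ψ = Ψ'`, is strictly increasing, because `f(τ)/|τ|` is. Dividing the critical point equations
by `t` and `s` gives `ψ₁(t)/t = a + c s/t` and `ψ₂(s)/s = b + c t/s`; comparing the ratios `s/t` of
two critical points forces them to coincide (`FiberProfile.crit_unique`). The same monotonicity
gives the signs in (iii).

The analytic work is to show that these objects exist. `D^{α,2}` is stable under `u ↦ t u⁺ + s u⁻`
(`memD_comb`) and embeds into the Lebesgue space of critical exponent (`MemD.integrable_rpow`). With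
the growth bound `|K f(t) t| ≤ C (V t² + |t|^P)`, `P` the critical exponent
(`ClassK.exists_growth`), this makes the nonlinear integrals finite and differentiable in the
parameter. -/

/-! ### Gagliardo energy of test functions and the fractional Sobolev inequality -/

section Gagliardo

variable {N : ℕ} {α : ℝ}

/-- The square of the Gagliardo seminorm. -/
noncomputable def gagliardoEnergy (α : ℝ) (v : Rn N → ℝ) : ℝ≥0∞ :=
  ∫⁻ p : Rn N × Rn N,
    ENNReal.ofReal (|v p.1 - v p.2| ^ 2 / ‖p.1 - p.2‖ ^ ((N : ℝ) + 2 * α))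

theorem gagliardo_eq_rpow (v : Rn N → ℝ) :
    gagliardo α v = gagliardoEnergy α v ^ (1 / 2 : ℝ) := rfl

theorem gagliardo_sq (v : Rn N → ℝ) : gagliardo α v ^ (2 : ℝ) = gagliardoEnergy α v := by
  rw [gagliardo_eq_rpow, ← ENNReal.rpow_mul]; norm_num

/-- In polar coordinates the radial integrand is at most `A r^(1 - 2α)` near the origin, integrable
because `α < 1`, and at most `B r^(-1 - 2α)` at infinity, integrable because `α > 0`. -/
theorem integrable_min_kernel (hα0 : 0 < α) (hα1 : α < 1) (hN : 0 < N) {A B : ℝ} (hA : 0 ≤ A)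
    (hB : 0 ≤ B) :
    Integrable (fun z : Rn N => min (A * ‖z‖ ^ 2) B / ‖z‖ ^ ((N : ℝ) + 2 * α)) := by
  have : Nonempty (Fin N) := ⟨⟨0, hN⟩⟩
  have key := integrable_fun_norm_addHaar (E := Rn N) volume
    (f := fun r : ℝ => min (A * r ^ 2) B / r ^ ((N : ℝ) + 2 * α))
  refine key.2 ?_
  simp only [finrank_euclideanSpace_fin, smul_eq_mul]
  have hmeas : Measurable fun y : ℝ =>
      y ^ (N - 1) * (min (A * y ^ 2) B / y ^ ((N : ℝ) + 2 * α)) := by fun_prop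
  have hNc : ((N - 1 : ℕ) : ℝ) = (N : ℝ) - 1 := by
    rw [Nat.cast_sub hN]; simp
  rw [← Set.Ioc_union_Ioi_eq_Ioi (zero_le_one' ℝ), integrableOn_union]
  constructor
  · have h1 : IntegrableOn (fun x : ℝ => A * x ^ (1 - 2 * α)) (Set.Ioc 0 1) := by
      refine Integrable.const_mul ?_ A
      have := intervalIntegral.intervalIntegrable_rpow' (a := 0) (b := 1) (r := 1 - 2 * α)
        (by linarith)
      rwa [intervalIntegrable_iff_integrableOn_Ioc_of_le zero_le_one] at this
    refine h1.mono' hmeas.aestronglyMeasurable ?_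
    filter_upwards [ae_restrict_mem measurableSet_Ioc] with y hy
    have hy0 : 0 < y := hy.1
    rw [Real.norm_of_nonneg (by positivity)]
    calc y ^ (N - 1) * (min (A * y ^ 2) B / y ^ ((N : ℝ) + 2 * α))
        ≤ y ^ (N - 1) * ((A * y ^ 2) / y ^ ((N : ℝ) + 2 * α)) := by
          gcongr; exact min_le_left _ _
      _ = A * y ^ (1 - 2 * α) := by
          rw [← Real.rpow_natCast, ← Real.rpow_natCast, hNc, mul_div_assoc, ← Real.rpow_sub hy0,
            mul_left_comm, ← Real.rpow_add hy0]
          congr 2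
          push_cast
          ring
  · have h1 : IntegrableOn (fun x : ℝ => B * x ^ (-1 - 2 * α)) (Set.Ioi 1) :=
      (integrableOn_Ioi_rpow_of_lt (by linarith) one_pos).const_mul B
    refine h1.mono' hmeas.aestronglyMeasurable ?_
    filter_upwards [ae_restrict_mem measurableSet_Ioi] with y hy
    have hy0 : 0 < y := lt_trans one_pos hy
    rw [Real.norm_of_nonneg (by positivity)]
    calc y ^ (N - 1) * (min (A * y ^ 2) B / y ^ ((N : ℝ) + 2 * α))
        ≤ y ^ (N - 1) * (B / y ^ ((N : ℝ) + 2 * α)) := by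
          gcongr; exact min_le_right _ _
      _ = B * y ^ (-1 - 2 * α) := by
          rw [← Real.rpow_natCast, hNc, div_eq_mul_inv, ← Real.rpow_neg hy0.le,
            mul_left_comm, ← Real.rpow_add hy0]
          congr 2
          ring

/-- Test functions have finite Gagliardo energy. -/
theorem gagliardoEnergy_lt_top (hα0 : 0 < α) (hα1 : α < 1) (hN : 0 < N) {φ : Rn N → ℝ}
    (hφ : ContDiff ℝ ((⊤ : ℕ∞) : WithTop ℕ∞) φ) (hc : HasCompactSupport φ) :
    gagliardoEnergy α φ < ⊤ := by
  obtain ⟨L, hL⟩ := ContDiff.lipschitzWith_of_hasCompactSupport hc hφ (by simp)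
  obtain ⟨M, hM⟩ := hc.exists_bound_of_continuous hφ.continuous
  have hM0 : 0 ≤ M := (norm_nonneg _).trans (hM 0)
  set κ : Rn N → ℝ≥0∞ := fun z =>
    ENNReal.ofReal (min ((L : ℝ) ^ 2 * ‖z‖ ^ 2) ((2 * M) ^ 2) / ‖z‖ ^ ((N : ℝ) + 2 * α)) with hκ
  have hκm : Measurable κ := by fun_prop
  have hκfin : ∫⁻ z, κ z < ⊤ :=
    (integrable_min_kernel hα0 hα1 hN (by positivity) (by positivity)).lintegral_lt_top
  set S := tsupport φ
  have hSm : MeasurableSet S := (isClosed_tsupport φ).measurableSet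
  have hSfin : volume S < ⊤ := IsCompact.measure_lt_top hc
  -- The difference quotient vanishes unless one of the two points lies in the support. `G` and `H`
  -- treat these two cases, and translation invariance gives each the integral `volume S * ∫ κ`.
  set G : Rn N × Rn N → ℝ≥0∞ := fun p => S.indicator 1 p.1 * κ (p.1 - p.2) with hG
  set H : Rn N × Rn N → ℝ≥0∞ := fun p => S.indicator 1 p.2 * κ (p.1 - p.2) with hH
  have hind : Measurable (S.indicator (1 : Rn N → ℝ≥0∞)) := measurable_one.indicator hSm
  have hGm : Measurable G :=
    (hind.comp measurable_fst).mul (hκm.comp (measurable_fst.sub measurable_snd))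
  have hHm : Measurable H :=
    (hind.comp measurable_snd).mul (hκm.comp (measurable_fst.sub measurable_snd))
  have hGfin : ∫⁻ p, G p < ⊤ := by
    rw [Measure.volume_eq_prod, lintegral_prod _ hGm.aemeasurable]
    have : ∀ x, ∫⁻ y, G (x, y) = S.indicator 1 x * ∫⁻ z, κ z := by
      intro x
      simp only [hG]
      rw [lintegral_const_mul _ (by fun_prop),
        lintegral_sub_left_eq_self κ x]
    simp only [this]
    rw [lintegral_mul_const _ hind, lintegral_indicator_one hSm]
    exact ENNReal.mul_lt_top hSfin hκfin
  have hHfin : ∫⁻ p, H p < ⊤ := by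
    rw [Measure.volume_eq_prod, lintegral_prod_symm _ hHm.aemeasurable]
    have : ∀ y, ∫⁻ x, H (x, y) = S.indicator 1 y * ∫⁻ z, κ z := by
      intro y
      simp only [hH]
      rw [lintegral_const_mul _ (by fun_prop),
        lintegral_sub_right_eq_self κ y]
    simp only [this]
    rw [lintegral_mul_const _ hind, lintegral_indicator_one hSm]
    exact ENNReal.mul_lt_top hSfin hκfin
  have hle : gagliardoEnergy α φ ≤ ∫⁻ p, (G p + H p) := by
    refine lintegral_mono fun p => ?_
    have hb : ENNReal.ofReal (|φ p.1 - φ p.2| ^ 2 / ‖p.1 - p.2‖ ^ ((N : ℝ) + 2 * α))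
        ≤ κ (p.1 - p.2) := by
      simp only [hκ]
      gcongr
      refine le_min ?_ ?_
      · rw [← mul_pow]
        have := hL.dist_le_mul p.1 p.2
        rw [dist_eq_norm, dist_eq_norm, Real.norm_eq_abs] at this
        gcongr
      · have h1 := hM p.1
        have h2 := hM p.2
        rw [Real.norm_eq_abs] at h1 h2
        have := abs_sub (φ p.1) (φ p.2)
        gcongr
        linarith
    by_cases h1 : p.1 ∈ S
    · refine hb.trans (le_trans ?_ le_self_add)
      simp [hG, h1]
    by_cases h2 : p.2 ∈ S
    · refine hb.trans (le_trans ?_ le_add_self)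
      simp [hH, h2]
    · simp [image_eq_zero_of_notMem_tsupport h1, image_eq_zero_of_notMem_tsupport h2]
  refine hle.trans_lt ?_
  rw [lintegral_add_left hGm]
  exact ENNReal.add_lt_top.2 ⟨hGfin, hHfin⟩

theorem critExp_pos (hα0 : 0 < α) (hN : 2 * α < (N : ℝ)) : 0 < critExp α N := by
  have : 0 < (N : ℝ) := by linarith
  exact div_pos (by linarith) (by linarith)

theorem two_lt_critExp (hα0 : 0 < α) (hN : 2 * α < (N : ℝ)) : 2 < critExp α N := by
  rw [critExp, lt_div_iff₀ (by linarith)]; linarith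

/-- The pointwise estimate behind the fractional Sobolev inequality: a large value of `|φ|` at `x`
forces the inner Gagliardo integral at `x` to be large. -/
theorem rpow_abs_le_inner_gagliardo (hα0 : 0 < α) (hN : 2 * α < (N : ℝ)) :
    ∃ C₀ > 0, ∀ φ : Rn N → ℝ, Measurable φ → Integrable (fun x => |φ x| ^ critExp α N) →
      0 < ∫ x, |φ x| ^ critExp α N → ∀ x,
        ENNReal.ofReal (C₀ * (∫ y, |φ y| ^ critExp α N) ^ (-(2 * α / N)) *
          |φ x| ^ critExp α N) ≤
        ∫⁻ y, ENNReal.ofReal (|φ x - φ y| ^ 2 / ‖x - y‖ ^ ((N : ℝ) + 2 * α)) := by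
  have hNr : 0 < (N : ℝ) := by linarith
  have hNpos : 0 < N := by exact_mod_cast hNr
  have : Nonempty (Fin N) := ⟨⟨0, hNpos⟩⟩
  set P := critExp α N with hP
  have hP0 : 0 < P := critExp_pos hα0 hN
  -- This identity, which characterises the critical exponent, is what turns `a² q^(-2α/N)` into a
  -- multiple of `a^P` at the end.
  have hPeq : P = 2 + 2 * α * P / N := by
    rw [hP, critExp]
    have : (N : ℝ) - 2 * α ≠ 0 := by linarith
    field_simp
    ring
  set c := volume.real (Metric.ball (0 : Rn N) 1) with hc
  have hc0 : 0 < c := by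
    rw [hc, measureReal_def]
    exact ENNReal.toReal_pos (Metric.measure_ball_pos volume _ one_pos).ne' measure_ball_lt_top.ne
  refine ⟨c / 8 * (c / (2 * 2 ^ P)) ^ (2 * α / N), by positivity, ?_⟩
  intro φ hφ hint hm x
  set m := ∫ y, |φ y| ^ P with hm_def
  rcases eq_or_ne (φ x) 0 with h0 | h0
  · simp [h0, Real.zero_rpow hP0.ne']
  set a := |φ x| with ha_def
  have ha : 0 < a := abs_pos.2 h0
  -- The ball of radius `q^(1/N)` has volume `q c`, twice the Chebyshev bound `m (2/a)^P` for the
  -- set where `|φ| ≥ a/2`. So on at least half of the ball `|φ| < a/2`, and there `φ` differs from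
  -- `φ x` by at least `a/2`.
  set q := 2 * 2 ^ P * m / (c * a ^ P) with hq
  have hq0 : 0 < q := by positivity
  set r := q ^ (1 / N : ℝ) with hr
  have hr0 : 0 < r := by positivity
  have hrN : r ^ N = q := by
    rw [hr, ← Real.rpow_natCast, ← Real.rpow_mul hq0.le]
    simp [hNr.ne']
  have hball : volume.real (Metric.ball x r) = q * c := by
    rw [measureReal_def, Measure.addHaar_ball_of_pos _ _ hr0, ENNReal.toReal_mul,
      ENNReal.toReal_ofReal (by positivity), finrank_euclideanSpace_fin, hrN, hc, measureReal_def]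
  set T : Set (Rn N) := {y | a / 2 ≤ |φ y|} with hT
  have hTm : MeasurableSet T := measurableSet_le measurable_const hφ.abs
  have hcheb : (a / 2) ^ P * volume.real T ≤ m := by
    have h1 := mul_meas_ge_le_integral_of_nonneg (μ := volume) (f := fun y => |φ y| ^ P)
      (Eventually.of_forall fun y => by positivity) hint ((a / 2) ^ P)
    refine le_trans (le_of_eq ?_) h1
    congr 2
    ext y
    simp only [hT, Set.mem_ofPred_eq]
    rw [Real.rpow_le_rpow_iff (by positivity) (by positivity) hP0]
  have hTfin : volume T ≠ ⊤ := by
    have h1 := mul_meas_ge_le_lintegral₀ (μ := volume) (f := fun y => ENNReal.ofReal (|φ y| ^ P))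
      (by fun_prop) (ENNReal.ofReal ((a / 2) ^ P))
    have h2 := hint.lintegral_lt_top
    intro htop
    have h3 : T ⊆ {y | ENNReal.ofReal ((a / 2) ^ P) ≤ ENNReal.ofReal (|φ y| ^ P)} := by
      intro y hy
      have : a / 2 ≤ |φ y| := hy
      simp only [Set.mem_ofPred_eq]
      gcongr
    have h4 := measure_mono_top h3 htop
    rw [h4, ENNReal.mul_top (by simpa using by positivity)] at h1
    exact absurd (h1.trans_lt h2) (lt_irrefl _)
  have hTle : volume.real T ≤ q * c / 2 := by
    have : (a / 2) ^ P * (q * c / 2) = m := by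
      rw [hq, Real.div_rpow ha.le (by norm_num)]
      field_simp
    rw [← this] at hcheb
    exact le_of_mul_le_mul_left hcheb (by positivity)
  set S := Metric.ball x r \ T with hS
  have hSm : MeasurableSet S := measurableSet_ball.diff hTm
  have hSge : q * c / 2 ≤ volume.real S := by
    have := le_measureReal_sdiff (μ := volume) (s₁ := Metric.ball x r) (s₂ := T) hTfin
    rw [hball] at this
    linarith
  have hlow : ∀ y ∈ S, (a / 2) ^ 2 / r ^ ((N : ℝ) + 2 * α) ≤
      |φ x - φ y| ^ 2 / ‖x - y‖ ^ ((N : ℝ) + 2 * α) := by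
    intro y hy
    have hy1 : ‖x - y‖ < r := by
      have := hy.1
      rwa [Metric.mem_ball', dist_eq_norm] at this
    have hy2 : |φ y| < a / 2 := not_le.1 hy.2
    have hne : x ≠ y := by
      rintro rfl
      rw [← ha_def] at hy2
      linarith
    have hpos : 0 < ‖x - y‖ := norm_pos_iff.2 (sub_ne_zero.2 hne)
    have := abs_sub_abs_le_abs_sub (φ x) (φ y)
    gcongr
    linarith
  calc ENNReal.ofReal (c / 8 * (c / (2 * 2 ^ P)) ^ (2 * α / N) * m ^ (-(2 * α / N)) * a ^ P)
      = ENNReal.ofReal ((a / 2) ^ 2 / r ^ ((N : ℝ) + 2 * α) * (q * c / 2)) := by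
        congr 1
        have e1 : r ^ ((N : ℝ) + 2 * α) = q * q ^ (2 * α / N) := by
          rw [Real.rpow_add hr0, Real.rpow_natCast, hrN, hr, ← Real.rpow_mul hq0.le]
          congr 2
          ring
        have e2 : q ^ (2 * α / N) = ((c / (2 * 2 ^ P)) ^ (2 * α / N))⁻¹ * m ^ (2 * α / N) *
            (a ^ (2 * α * P / N))⁻¹ := by
          rw [← Real.inv_rpow (by positivity),
            show 2 * α * P / N = P * (2 * α / N) by ring, Real.rpow_mul ha.le,
            ← Real.inv_rpow (by positivity), ← Real.mul_rpow (by positivity) (by positivity),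
            ← Real.mul_rpow (by positivity) (by positivity)]
          congr 1
          rw [hq]
          field_simp
        have e3 : a ^ P = a ^ 2 * a ^ (2 * α * P / N) := by
          conv_lhs => rw [hPeq]
          rw [Real.rpow_add ha]
          norm_cast
        have e4 : 0 < (c / (2 * 2 ^ P)) ^ (2 * α / N) := by positivity
        have e5 : 0 < m ^ (2 * α / N) := by positivity
        have e6 : 0 < a ^ (2 * α * P / N) := by positivity
        rw [e1, e2, e3, Real.rpow_neg hm.le]
        field_simp
        ring
    _ ≤ ENNReal.ofReal ((a / 2) ^ 2 / r ^ ((N : ℝ) + 2 * α)) * volume S := by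
        rw [ENNReal.ofReal_mul (by positivity)]
        gcongr
        refine (ENNReal.ofReal_le_ofReal hSge).trans ?_
        rw [measureReal_def]
        exact ENNReal.ofReal_toReal_le
    _ = ∫⁻ y in S, ENNReal.ofReal ((a / 2) ^ 2 / r ^ ((N : ℝ) + 2 * α)) := by
        rw [setLIntegral_const]
    _ ≤ ∫⁻ y in S, ENNReal.ofReal (|φ x - φ y| ^ 2 / ‖x - y‖ ^ ((N : ℝ) + 2 * α)) :=
        setLIntegral_mono' hSm fun y hy => ENNReal.ofReal_le_ofReal (hlow y hy)
    _ ≤ _ := setLIntegral_le_lintegral _ _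

/-- The fractional Sobolev inequality for continuous functions of compact support. -/
theorem fractional_sobolev (hα0 : 0 < α) (hN : 2 * α < (N : ℝ)) :
    ∃ C₀ > 0, ∀ φ : Rn N → ℝ, Continuous φ → HasCompactSupport φ →
      ENNReal.ofReal (C₀ * (∫ y, |φ y| ^ critExp α N) ^ (1 - 2 * α / N)) ≤
        gagliardoEnergy α φ := by
  have hNr : 0 < (N : ℝ) := by linarith
  have hP0 : 0 < critExp α N := critExp_pos hα0 hN
  obtain ⟨C₀, hC₀, h⟩ := rpow_abs_le_inner_gagliardo hα0 hN
  refine ⟨C₀, hC₀, fun φ hφ hc => ?_⟩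
  set P := critExp α N
  have hcont : Continuous fun x => |φ x| ^ P :=
    hφ.abs.rpow_const fun x => Or.inr hP0.le
  have hint : Integrable fun x => |φ x| ^ P :=
    hcont.integrable_of_hasCompactSupport (hc.comp_left (g := fun t => |t| ^ P)
      (by simp [Real.zero_rpow hP0.ne']))
  have hm0 : 0 ≤ ∫ y, |φ y| ^ P := integral_nonneg fun y => by positivity
  have hexp : 0 < 1 - 2 * α / N := by
    rw [sub_pos, div_lt_one hNr]; exact hN
  rcases hm0.eq_or_lt with hm | hm
  · rw [← hm, Real.zero_rpow hexp.ne']; simp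
  have hmeas : AEMeasurable (fun p : Rn N × Rn N =>
      ENNReal.ofReal (|φ p.1 - φ p.2| ^ 2 / ‖p.1 - p.2‖ ^ ((N : ℝ) + 2 * α)))
      (volume.prod volume) := by
    have := hφ.measurable
    have : Measurable fun p : Rn N × Rn N => φ p.1 - φ p.2 :=
      (this.comp measurable_fst).sub (this.comp measurable_snd)
    fun_prop
  rw [gagliardoEnergy, Measure.volume_eq_prod, lintegral_prod _ hmeas]
  -- Integrating the pointwise bound over `x` contributes one more factor of the total mass, which
  -- makes the exponent `1 - 2α/N`.
  refine le_trans (le_of_eq ?_) (lintegral_mono (h φ hφ.measurable hint hm))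
  rw [← ofReal_integral_eq_lintegral_ofReal (hint.const_mul _)
    (Eventually.of_forall fun x => by positivity), integral_const_mul]
  congr 1
  rw [sub_eq_add_neg, Real.rpow_add hm, Real.rpow_one]
  ring

end Gagliardo

/-! ### The space `D^{α,2}`: finite energy, critical embedding, stability under truncation -/

/-- Dominated convergence with a dominating function that is only bounded up to an error
tending to zero in mean. -/
theorem tendsto_lintegral_zero_of_le_add {X : Type*} [MeasurableSpace X] {μ : Measure X}
    {g e : ℕ → X → ℝ≥0∞} {b : X → ℝ≥0∞} (hg : ∀ n, AEMeasurable (g n) μ)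
    (he : ∀ n, AEMeasurable (e n) μ) (hle : ∀ n x, g n x ≤ e n x + b x)
    (he0 : Tendsto (fun n => ∫⁻ x, e n x ∂μ) atTop (𝓝 0)) (hb : ∫⁻ x, b x ∂μ ≠ ⊤)
    (hg0 : ∀ᵐ x ∂μ, Tendsto (fun n => g n x) atTop (𝓝 0)) :
    Tendsto (fun n => ∫⁻ x, g n x ∂μ) atTop (𝓝 0) := by
  -- The truncated difference `g n - e n` is dominated by the fixed function `b`, so ordinary
  -- dominated convergence applies to it.
  have h1 : Tendsto (fun n => ∫⁻ x, (g n x - e n x) ∂μ) atTop (𝓝 0) := by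
    have := tendsto_lintegral_of_dominated_convergence' (μ := μ)
      (F := fun n x => g n x - e n x) (f := fun _ => 0) b (fun n => (hg n).sub (he n))
      (fun n => Eventually.of_forall fun x => tsub_le_iff_left.2 (hle n x)) hb ?_
    · simpa using this
    · filter_upwards [hg0] with x hx
      exact tendsto_of_tendsto_of_tendsto_of_le_of_le tendsto_const_nhds hx
        (fun _ => zero_le) (fun _ => tsub_le_self)
  have h2 := h1.add he0
  rw [add_zero] at h2
  refine tendsto_of_tendsto_of_tendsto_of_le_of_le tendsto_const_nhds h2
    (fun _ => zero_le) (fun n => ?_)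
  simp only
  rw [← lintegral_add_right' _ (he n)]
  exact lintegral_mono fun x => le_tsub_add

section Gagliardo

variable {N : ℕ} {α : ℝ}

theorem aestronglyMeasurable_diff {v : Rn N → ℝ} (hv : AEStronglyMeasurable v) :
    AEStronglyMeasurable (fun p : Rn N × Rn N => v p.1 - v p.2) := by
  rw [Measure.volume_eq_prod]
  exact hv.comp_fst.sub hv.comp_snd

theorem aemeasurable_gagliardo {v : Rn N → ℝ} (hv : AEStronglyMeasurable v) :
    AEMeasurable (fun p : Rn N × Rn N =>
      ENNReal.ofReal (|v p.1 - v p.2| ^ 2 / ‖p.1 - p.2‖ ^ ((N : ℝ) + 2 * α))) := by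
  have := (aestronglyMeasurable_diff hv).aemeasurable
  have h2 : Measurable fun p : Rn N × Rn N => ‖p.1 - p.2‖ ^ ((N : ℝ) + 2 * α) := by fun_prop
  have h3 : AEMeasurable fun p : Rn N × Rn N => |v p.1 - v p.2| ^ 2 := by
    simpa only [sq_abs] using this.pow_const 2
  exact (h3.div h2.aemeasurable).ennreal_ofReal

theorem gagliardoEnergy_le_of_abs_le {v w : Rn N → ℝ}
    (h : ∀ x y, |v x - v y| ≤ |w x - w y|) : gagliardoEnergy α v ≤ gagliardoEnergy α w := by
  refine lintegral_mono fun p => ?_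
  have := h p.1 p.2
  gcongr

theorem gagliardoEnergy_le_add {v w : Rn N → ℝ} (hw : AEStronglyMeasurable w) :
    gagliardoEnergy α v ≤
      2 * gagliardoEnergy α w + 2 * gagliardoEnergy α (fun x => w x - v x) := by
  have h2 : (2 : ℝ≥0∞) = ENNReal.ofReal 2 := by simp
  simp only [gagliardoEnergy]
  conv_rhs => enter [1, 1]; rw [h2]
  conv_rhs => enter [2, 1]; rw [h2]
  rw [← lintegral_const_mul' _ _ (by simp), ← lintegral_const_mul' _ _ (by simp),
    ← lintegral_add_left' ((aemeasurable_gagliardo hw).const_mul _)]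
  refine lintegral_mono fun p => ?_
  rw [← ENNReal.ofReal_mul (by norm_num), ← ENNReal.ofReal_mul (by norm_num),
    ← ENNReal.ofReal_add (by positivity) (by positivity)]
  refine ENNReal.ofReal_le_ofReal ?_
  rw [← mul_div_assoc, ← mul_div_assoc, ← add_div]
  gcongr
  simp only [sq_abs]
  nlinarith [sq_nonneg ((w p.1 - w p.2) + (w p.1 - v p.1 - (w p.2 - v p.2)))]

theorem tendsto_gagliardo_iff {ι : Type*} {l : Filter ι} {v : ι → Rn N → ℝ} :
    Tendsto (fun n => gagliardo α (v n)) l (𝓝 0) ↔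
      Tendsto (fun n => gagliardoEnergy α (v n)) l (𝓝 0) := by
  constructor <;> intro h
  · simp_rw [← gagliardo_sq]
    have := (ENNReal.continuous_rpow_const (y := 2)).continuousAt.tendsto.comp h
    simpa [Function.comp_def] using this
  · simp_rw [gagliardo_eq_rpow]
    have := (ENNReal.continuous_rpow_const (y := 1 / 2)).continuousAt.tendsto.comp h
    simpa [Function.comp_def] using this

/-- Measurable functions of finite Gagliardo energy. -/
structure FiniteGagliardo (α : ℝ) (v : Rn N → ℝ) : Prop where
  meas : AEStronglyMeasurable v
  lt_top : gagliardoEnergy α v < ⊤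

theorem FiniteGagliardo.integrable_sq {v : Rn N → ℝ} (hv : FiniteGagliardo α v) :
    Integrable fun p : Rn N × Rn N =>
      |v p.1 - v p.2| ^ 2 / ‖p.1 - p.2‖ ^ ((N : ℝ) + 2 * α) := by
  have h1 := (aestronglyMeasurable_diff hv.meas).aemeasurable
  have h2 : Measurable fun p : Rn N × Rn N => ‖p.1 - p.2‖ ^ ((N : ℝ) + 2 * α) := by fun_prop
  have h3 : AEMeasurable fun p : Rn N × Rn N => |v p.1 - v p.2| ^ 2 := by
    simpa only [sq_abs] using h1.pow_const 2
  exact (lintegral_ofReal_ne_top_iff_integrable (h3.div h2.aemeasurable).aestronglyMeasurable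
    (Eventually.of_forall fun p => by
      simp only [Pi.zero_apply, Pi.div_apply]; positivity)).1 hv.lt_top.ne

theorem FiniteGagliardo.integrable_mul {v w : Rn N → ℝ} (hv : FiniteGagliardo α v)
    (hw : FiniteGagliardo α w) :
    Integrable fun p : Rn N × Rn N =>
      (v p.1 - v p.2) * (w p.1 - w p.2) / ‖p.1 - p.2‖ ^ ((N : ℝ) + 2 * α) := by
  have h1 := (aestronglyMeasurable_diff hv.meas).aemeasurable
  have h1' := (aestronglyMeasurable_diff hw.meas).aemeasurable
  have h2 : Measurable fun p : Rn N × Rn N => ‖p.1 - p.2‖ ^ ((N : ℝ) + 2 * α) := by fun_prop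
  refine (hv.integrable_sq.add hw.integrable_sq).mono'
    ((h1.mul h1').div h2.aemeasurable).aestronglyMeasurable (Eventually.of_forall fun p => ?_)
  simp only [Pi.add_apply]
  rw [← add_div, norm_div, norm_mul, Real.norm_eq_abs, Real.norm_eq_abs,
    Real.norm_of_nonneg (by positivity : 0 ≤ ‖p.1 - p.2‖ ^ ((N : ℝ) + 2 * α))]
  gcongr
  nlinarith [sq_nonneg (|v p.1 - v p.2| - |w p.1 - w p.2|), sq_nonneg (|v p.1 - v p.2|),
    sq_nonneg (|w p.1 - w p.2|)]

theorem FiniteGagliardo.gagliardo_toReal_sq {v : Rn N → ℝ} (hv : FiniteGagliardo α v) :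
    (gagliardo α v).toReal ^ 2 = gagliardoForm α v v := by
  have h1 : (gagliardo α v).toReal ^ 2 = (gagliardoEnergy α v).toReal := by
    rw [← gagliardo_sq, ← ENNReal.toReal_rpow]; norm_cast
  rw [h1, gagliardoEnergy, gagliardoForm, ← integral_eq_lintegral_of_nonneg_ae
    (Eventually.of_forall fun p => by positivity) hv.integrable_sq.aestronglyMeasurable]
  simp_rw [sq_abs, pow_two]

theorem gagliardoForm_comm (v w : Rn N → ℝ) : gagliardoForm α v w = gagliardoForm α w v := by
  simp only [gagliardoForm, mul_comm]

theorem FiniteGagliardo.gagliardoForm_lin {v w z : Rn N → ℝ} (hv : FiniteGagliardo α v)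
    (hw : FiniteGagliardo α w) (hz : FiniteGagliardo α z) (t s : ℝ) :
    gagliardoForm α (fun x => t * v x + s * w x) z =
      t * gagliardoForm α v z + s * gagliardoForm α w z := by
  simp only [gagliardoForm]
  rw [← integral_const_mul, ← integral_const_mul,
    ← integral_add ((hv.integrable_mul hz).const_mul t) ((hw.integrable_mul hz).const_mul s)]
  congr 1
  ext p
  ring

theorem FracSchrodinger.MemD.aestronglyMeasurable {u : Rn N → ℝ} (hu : MemD α u) : AEStronglyMeasurable u := by
  obtain ⟨φ, h1, h2, -⟩ := hu
  exact aestronglyMeasurable_of_tendsto_ae atTop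
    (fun n => (h1 n).1.continuous.aestronglyMeasurable) h2

theorem FracSchrodinger.MemD.finiteGagliardo (hα0 : 0 < α) (hα1 : α < 1) (hN : 2 * α < (N : ℝ)) {u : Rn N → ℝ}
    (hu : MemD α u) : FiniteGagliardo α u := by
  refine ⟨hu.aestronglyMeasurable, ?_⟩
  have hNpos : 0 < N := by
    have : 0 < (N : ℝ) := by linarith
    exact_mod_cast this
  obtain ⟨φ, h1, -, h3⟩ := hu
  rw [tendsto_gagliardo_iff] at h3
  -- A single test function at energy distance less than one from `u` suffices.
  obtain ⟨n, hn⟩ := (h3.eventually_lt_const (zero_lt_one' ℝ≥0∞)).exists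
  refine (gagliardoEnergy_le_add (h1 n).1.continuous.aestronglyMeasurable).trans_lt ?_
  refine ENNReal.add_lt_top.2 ⟨ENNReal.mul_lt_top (by simp)
    (gagliardoEnergy_lt_top hα0 hα1 hNpos (h1 n).1 (h1 n).2), ENNReal.mul_lt_top (by simp)
    (hn.trans (by simp))⟩

/-- The embedding of `D^{α,2}` into the Lebesgue space of critical exponent. -/
theorem FracSchrodinger.MemD.integrable_rpow (hα0 : 0 < α) (hα1 : α < 1) (hN : 2 * α < (N : ℝ)) {u : Rn N → ℝ}
    (hu : MemD α u) : Integrable fun x => |u x| ^ critExp α N := by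
  have hfin := (hu.finiteGagliardo hα0 hα1 hN).lt_top
  have hmeas := hu.aestronglyMeasurable
  have hNr : 0 < (N : ℝ) := by linarith
  have hP0 : 0 < critExp α N := critExp_pos hα0 hN
  obtain ⟨C₀, hC₀, hsob⟩ := fractional_sobolev hα0 hN
  obtain ⟨φ, h1, h2, h3⟩ := hu
  rw [tendsto_gagliardo_iff] at h3
  set P := critExp α N
  set B : ℝ≥0∞ := 2 * gagliardoEnergy α u + 2 with hB
  have hBtop : B ≠ ⊤ := by simp [hB, ENNReal.mul_eq_top, hfin.ne]
  have hexp : 0 < 1 - 2 * α / N := by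
    rw [sub_pos, div_lt_one hNr]; exact hN
  have hev : ∀ᶠ n in atTop, ∫⁻ x, ENNReal.ofReal (|φ n x| ^ P) ≤
      ENNReal.ofReal ((B.toReal / C₀) ^ (1 - 2 * α / N)⁻¹) := by
    filter_upwards [h3.eventually_lt_const (zero_lt_one' ℝ≥0∞)] with n hn
    have hcont : Continuous (φ n) := (h1 n).1.continuous
    have hint : Integrable fun x => |φ n x| ^ P :=
      (hcont.abs.rpow_const fun x => Or.inr hP0.le).integrable_of_hasCompactSupport
        ((h1 n).2.comp_left (g := fun t => |t| ^ P) (by simp [Real.zero_rpow hP0.ne']))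
    have hle : gagliardoEnergy α (φ n) ≤ B := by
      refine (gagliardoEnergy_le_add hmeas).trans ?_
      have heq : gagliardoEnergy α (fun x => u x - φ n x) =
          gagliardoEnergy α (fun x => φ n x - u x) := by
        refine le_antisymm (gagliardoEnergy_le_of_abs_le fun x y => ?_)
          (gagliardoEnergy_le_of_abs_le fun x y => ?_) <;>
        · rw [← abs_neg]
          apply le_of_eq
          congr 1
          ring
      rw [hB, heq]
      gcongr
      calc 2 * gagliardoEnergy α (fun x => φ n x - u x) ≤ 2 * 1 := by gcongr
        _ = 2 := mul_one _
    have h5 := (hsob (φ n) hcont (h1 n).2).trans hle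
    rw [ENNReal.ofReal_le_iff_le_toReal hBtop] at h5
    have hm0 : 0 ≤ ∫ y, |φ n y| ^ P := integral_nonneg fun y => by positivity
    rw [← ofReal_integral_eq_lintegral_ofReal hint (Eventually.of_forall fun x => by positivity)]
    refine ENNReal.ofReal_le_ofReal ?_
    rw [Real.le_rpow_inv_iff_of_pos hm0 (by positivity) hexp, le_div_iff₀ hC₀]
    linarith
  have hPm : AEStronglyMeasurable fun x => |u x| ^ P :=
    (hmeas.aemeasurable.abs.pow_const P).aestronglyMeasurable
  refine (lintegral_ofReal_ne_top_iff_integrable hPm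
    (Eventually.of_forall fun p => by positivity)).1 (ne_of_lt ?_)
  -- Fatou's lemma: the Sobolev inequality bounds the critical integrals of the approximants
  -- uniformly for large `n`, and these converge a.e.
  calc ∫⁻ x, ENNReal.ofReal (|u x| ^ P)
      = ∫⁻ x, liminf (fun n => ENNReal.ofReal (|φ n x| ^ P)) atTop := by
        refine lintegral_congr_ae ?_
        filter_upwards [h2] with x hx
        refine (Tendsto.liminf_eq ?_).symm
        exact (ENNReal.continuous_ofReal.tendsto _).comp
          (hx.abs.rpow_const (Or.inr hP0.le))
    _ ≤ liminf (fun n => ∫⁻ x, ENNReal.ofReal (|φ n x| ^ P)) atTop := by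
        refine lintegral_liminf_le' fun n => ?_
        have := (h1 n).1.continuous.measurable
        fun_prop
    _ ≤ ENNReal.ofReal ((B.toReal / C₀) ^ (1 - 2 * α / N)⁻¹) :=
        liminf_le_of_frequently_le' hev.frequently
    _ < ⊤ := ENNReal.ofReal_lt_top

/-- A smooth approximation of `τ ↦ t τ⁺ + s τ⁻` that vanishes at the origin. -/
noncomputable def smoothComb (t s ε τ : ℝ) : ℝ :=
  (t + s) / 2 * τ + (t - s) / 2 * (Real.sqrt (τ ^ 2 + ε ^ 2) - ε)

theorem contDiff_smoothComb (t s : ℝ) {ε : ℝ} (hε : 0 < ε) {n : WithTop ℕ∞} :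
    ContDiff ℝ n (smoothComb t s ε) := by
  unfold smoothComb
  have : ContDiff ℝ n fun τ : ℝ => Real.sqrt (τ ^ 2 + ε ^ 2) :=
    ContDiff.sqrt (by fun_prop) fun x => by positivity
  fun_prop

theorem smoothComb_zero (t s : ℝ) {ε : ℝ} (hε : 0 ≤ ε) : smoothComb t s ε 0 = 0 := by
  simp [smoothComb, Real.sqrt_sq hε]

theorem smoothComb_zero_eps (t s τ : ℝ) : smoothComb t s 0 τ = t * max τ 0 + s * min τ 0 := by
  have : Real.sqrt (τ ^ 2 + 0 ^ 2) = |τ| := by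
    rw [zero_pow two_ne_zero, add_zero, Real.sqrt_sq_eq_abs]
  rw [smoothComb, this]
  rcases le_total τ 0 with h | h
  · rw [max_eq_right h, min_eq_left h, abs_of_nonpos h]; ring
  · rw [max_eq_left h, min_eq_right h, abs_of_nonneg h]; ring

/-- This is the triangle inequality for the planar vectors `(a, ε)` and `(b, ε)`. The Lipschitz
constant does not depend on `ε`. -/
theorem sqrt_sq_add_sq_sub_le (a b ε : ℝ) :
    Real.sqrt (a ^ 2 + ε ^ 2) - Real.sqrt (b ^ 2 + ε ^ 2) ≤ |a - b| := by
  rw [sub_le_iff_le_add]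
  set S := Real.sqrt (b ^ 2 + ε ^ 2) with hS
  have hS0 : 0 ≤ S := Real.sqrt_nonneg _
  have hS2 : S ^ 2 = b ^ 2 + ε ^ 2 := Real.sq_sqrt (by positivity)
  have hb : |b| ≤ S := Real.abs_le_sqrt (by nlinarith [sq_nonneg ε])
  refine Real.sqrt_le_iff.2 ⟨by positivity, ?_⟩
  have h1 : (a - b) * b ≤ |a - b| * S := by
    refine (le_abs_self _).trans ?_
    rw [abs_mul]
    gcongr
  nlinarith [sq_abs (a - b)]

theorem abs_smoothComb_sub_le (t s ε a b : ℝ) :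
    |smoothComb t s ε a - smoothComb t s ε b| ≤ (|t| + |s|) * |a - b| := by
  have h1 : |Real.sqrt (a ^ 2 + ε ^ 2) - Real.sqrt (b ^ 2 + ε ^ 2)| ≤ |a - b| :=
    abs_le.2 ⟨by have := sqrt_sq_add_sq_sub_le b a ε; rw [abs_sub_comm] at this; linarith,
      sqrt_sq_add_sq_sub_le a b ε⟩
  have h2 : smoothComb t s ε a - smoothComb t s ε b = (t + s) / 2 * (a - b) +
      (t - s) / 2 * (Real.sqrt (a ^ 2 + ε ^ 2) - Real.sqrt (b ^ 2 + ε ^ 2)) := by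
    simp only [smoothComb]; ring
  rw [h2]
  refine (abs_add_le _ _).trans ?_
  rw [abs_mul, abs_mul]
  have h3 : |(t + s) / 2| ≤ (|t| + |s|) / 2 := by
    rw [abs_div, abs_two]; gcongr; exact abs_add_le t s
  have h4 : |(t - s) / 2| ≤ (|t| + |s|) / 2 := by
    rw [abs_div, abs_two]; gcongr; exact abs_sub t s
  calc _ ≤ (|t| + |s|) / 2 * |a - b| + (|t| + |s|) / 2 * |a - b| := by gcongr
    _ = _ := by ring

/-- With `C = |t| + |s|`, the increment is at most `C d₁ + 2 C d₂`, where `d₁` is the increment of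
the error `a - b` and `d₂` that of `b`; then `(x + y)² ≤ 2x² + 2y²`. The first term has vanishing
energy along an approximating sequence, while the second is fixed and serves as a dominating
function. -/
theorem sq_abs_smoothComb_sub_le (t s ε a₁ a₂ b₁ b₂ : ℝ) :
    |smoothComb t s ε a₁ - smoothComb t s 0 b₁ - (smoothComb t s ε a₂ - smoothComb t s 0 b₂)| ^ 2 ≤
      2 * (|t| + |s|) ^ 2 * |(a₁ - b₁) - (a₂ - b₂)| ^ 2 +
        8 * (|t| + |s|) ^ 2 * |b₁ - b₂| ^ 2 := by
  have i1 := abs_smoothComb_sub_le t s ε a₁ a₂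
  have i2 := abs_smoothComb_sub_le t s 0 b₁ b₂
  set C := |t| + |s| with hC_def
  have hC : 0 ≤ C := by positivity
  set d₁ := |(a₁ - b₁) - (a₂ - b₂)| with hd₁
  set d₂ := |b₁ - b₂| with hd₂
  have i3 : |a₁ - a₂| ≤ d₁ + d₂ := by
    refine le_trans (le_of_eq ?_) (abs_add_le _ _)
    congr 1
    ring
  have i4 : |smoothComb t s ε a₁ - smoothComb t s 0 b₁ -
      (smoothComb t s ε a₂ - smoothComb t s 0 b₂)| ≤ C * d₁ + 2 * C * d₂ := by
    rw [sub_sub_sub_comm]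
    refine (abs_sub _ _).trans ?_
    have : C * |a₁ - a₂| ≤ C * (d₁ + d₂) := by gcongr
    linarith
  calc _ ≤ (C * d₁ + 2 * C * d₂) ^ 2 := by gcongr
    _ ≤ _ := by nlinarith [sq_nonneg (C * d₁ - 2 * C * d₂)]

theorem comb_eq_smoothComb (u : Rn N → ℝ) (t s : ℝ) :
    comb u t s = fun x => smoothComb t s 0 (u x) := by
  ext x
  rw [smoothComb_zero_eps, comb, pos, neg]

/-- Composition with a Lipschitz map is not itself a contraction of differences, so convergence of
the composed sequence needs this argument: a bound by a vanishing part plus a fixed integrable part,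
and a.e. convergence on pairs inherited from that on points. -/
theorem tendsto_gagliardoEnergy_of_le {w e : ℕ → Rn N → ℝ} {v : Rn N → ℝ} {C D : ℝ} (hC : 0 ≤ C)
    (hD : 0 ≤ D) (hw : ∀ n, AEStronglyMeasurable (w n)) (he : ∀ n, AEStronglyMeasurable (e n))
    (hle : ∀ n x y, |w n x - w n y| ^ 2 ≤ C * |e n x - e n y| ^ 2 + D * |v x - v y| ^ 2)
    (he0 : Tendsto (fun n => gagliardoEnergy α (e n)) atTop (𝓝 0))
    (hv : gagliardoEnergy α v < ⊤) (hw0 : ∀ᵐ x, Tendsto (fun n => w n x) atTop (𝓝 0)) :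
    Tendsto (fun n => gagliardoEnergy α (w n)) atTop (𝓝 0) := by
  let q : (Rn N → ℝ) → Rn N × Rn N → ℝ≥0∞ := fun v p =>
    ENNReal.ofReal (|v p.1 - v p.2| ^ 2 / ‖p.1 - p.2‖ ^ ((N : ℝ) + 2 * α))
  have hq : ∀ v, gagliardoEnergy α v = ∫⁻ p, q v p := fun v => rfl
  simp only [hq] at he0 hv ⊢
  refine tendsto_lintegral_zero_of_le_add (g := fun n => q (w n))
    (e := fun n p => ENNReal.ofReal C * q (e n) p) (b := fun p => ENNReal.ofReal D * q v p)
    (fun n => aemeasurable_gagliardo (hw n)) (fun n => (aemeasurable_gagliardo (he n)).const_mul _)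
    ?_ ?_ ?_ ?_
  · intro n p
    simp only [q]
    rw [← ENNReal.ofReal_mul hC, ← ENNReal.ofReal_mul hD,
      ← ENNReal.ofReal_add (by positivity) (by positivity)]
    refine ENNReal.ofReal_le_ofReal ?_
    rw [← mul_div_assoc, ← mul_div_assoc, ← add_div]
    gcongr
    exact hle n p.1 p.2
  · simp_rw [lintegral_const_mul' _ _ ENNReal.ofReal_ne_top]
    have := ENNReal.Tendsto.const_mul (a := ENNReal.ofReal C) he0 (Or.inr ENNReal.ofReal_ne_top)
    rwa [mul_zero] at this
  · rw [lintegral_const_mul' _ _ ENNReal.ofReal_ne_top]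
    exact ENNReal.mul_ne_top ENNReal.ofReal_ne_top hv.ne
  · have hp1 : ∀ᵐ p : Rn N × Rn N, Tendsto (fun n => w n p.1) atTop (𝓝 0) := by
      rw [Measure.volume_eq_prod]
      exact Measure.quasiMeasurePreserving_fst.ae hw0
    have hp2 : ∀ᵐ p : Rn N × Rn N, Tendsto (fun n => w n p.2) atTop (𝓝 0) := by
      rw [Measure.volume_eq_prod]
      exact Measure.quasiMeasurePreserving_snd.ae hw0
    filter_upwards [hp1, hp2] with p q1 q2
    have l3 := (((q1.sub q2).abs.pow 2).div_const (‖p.1 - p.2‖ ^ ((N : ℝ) + 2 * α)))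
    have l4 := (ENNReal.continuous_ofReal.tendsto _).comp l3
    simpa [Function.comp_def, q] using l4

theorem continuous_smoothComb (t s : ℝ) :
    Continuous fun q : ℝ × ℝ => smoothComb t s q.1 q.2 := by
  unfold smoothComb; fun_prop

theorem continuous_smoothComb_right (t s ε : ℝ) : Continuous (smoothComb t s ε) := by
  unfold smoothComb; fun_prop

/-- `D^{α,2}` is stable under `u ↦ t u⁺ + s u⁻`. -/
theorem memD_comb (hα0 : 0 < α) (hα1 : α < 1) (hN : 2 * α < (N : ℝ)) {u : Rn N → ℝ}
    (hu : MemD α u) (t s : ℝ) : MemD α (comb u t s) := by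
  have hfin := (hu.finiteGagliardo hα0 hα1 hN).lt_top
  have hmeas := hu.aestronglyMeasurable
  obtain ⟨φ, h1, h2, h3⟩ := hu
  rw [tendsto_gagliardo_iff] at h3
  obtain ⟨ε, hεpos, hε0⟩ : ∃ ε : ℕ → ℝ, (∀ n, 0 < ε n) ∧ Tendsto ε atTop (𝓝 0) :=
    ⟨fun n => 1 / ((n : ℝ) + 1), fun n => by positivity, tendsto_one_div_add_atTop_nhds_zero_nat⟩
  have hlim : ∀ᵐ x, Tendsto (fun n => smoothComb t s (ε n) (φ n x)) atTop
      (𝓝 (smoothComb t s 0 (u x))) := by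
    filter_upwards [h2] with x hx
    have l1 : Tendsto (fun n => (ε n, φ n x)) atTop (𝓝 ((0 : ℝ), u x)) := hε0.prodMk_nhds hx
    have l2 := (continuous_smoothComb t s).tendsto ((0 : ℝ), u x)
    exact l2.comp l1
  have hcm : AEStronglyMeasurable fun x => smoothComb t s 0 (u x) :=
    (continuous_smoothComb_right t s 0).comp_aestronglyMeasurable hmeas
  have hψ : ∀ n, ContDiff ℝ ((⊤ : ℕ∞) : WithTop ℕ∞) fun x => smoothComb t s (ε n) (φ n x) :=
    fun n => (contDiff_smoothComb t s (hεpos n)).comp (h1 n).1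
  rw [comb_eq_smoothComb]
  -- Smoothing at scale `ε n → 0` keeps the approximants smooth, and the vanishing of `smoothComb`
  -- at the origin keeps their supports compact.
  refine ⟨fun n x => smoothComb t s (ε n) (φ n x), fun n => ⟨hψ n, ?_⟩, hlim, ?_⟩
  · exact (h1 n).2.comp_left (smoothComb_zero t s (hεpos n).le)
  rw [tendsto_gagliardo_iff]
  refine tendsto_gagliardoEnergy_of_le (C := 2 * (|t| + |s|) ^ 2) (D := 8 * (|t| + |s|) ^ 2)
    (by positivity) (by positivity)
    (fun n => (hψ n).continuous.aestronglyMeasurable.sub hcm)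
    (fun n => (h1 n).1.continuous.aestronglyMeasurable.sub hmeas)
    (fun n x y => sq_abs_smoothComb_sub_le t s (ε n) (φ n x) (φ n y) (u x) (u y)) h3 hfin ?_
  filter_upwards [hlim] with x hx
  simpa using hx.sub_const (smoothComb t s 0 (u x))

end Gagliardo

/-! ### The model fibering map on the quadrant -/

/-- The properties of the one-variable functions `t ↦ ∫ K F(t v)` that drive the fibering map. -/
structure FiberProfile (Ψ ψ : ℝ → ℝ) : Prop where
  hasDerivAt : ∀ t, HasDerivAt Ψ (ψ t) t
  strictMono : StrictMonoOn (fun t => ψ t / t) (Set.Ioi 0)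
  nonneg : ∀ t, 0 ≤ Ψ t
  map_zero : Ψ 0 = 0
  small : ∀ ε > 0, ∃ δ > 0, ∀ t, 0 < t → t < δ → Ψ t ≤ ε * t ^ 2
  large : ∀ M, ∃ R, 0 ≤ R ∧ ∀ t, R ≤ t → M * t ^ 2 ≤ Ψ t

/-- The model fibering map on the plane. -/
noncomputable def fiberMap (a b c : ℝ) (Ψ₁ Ψ₂ : ℝ → ℝ) (p : ℝ × ℝ) : ℝ :=
  1 / 2 * (a * p.1 ^ 2 + b * p.2 ^ 2) + c * p.1 * p.2 - Ψ₁ p.1 - Ψ₂ p.2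

theorem uniqueDiffWithinAt_quadrant {p : ℝ × ℝ} (hp : p ∈ quadrant) :
    UniqueDiffWithinAt ℝ quadrant p :=
  ((uniqueDiffOn_Ici 0).prod (uniqueDiffOn_Ici 0)) p hp

namespace FiberProfile

variable {Ψ₁ Ψ₂ ψ₁ ψ₂ : ℝ → ℝ} {a b c : ℝ}

theorem hasFDerivAt_fiberMap (h₁ : FiberProfile Ψ₁ ψ₁) (h₂ : FiberProfile Ψ₂ ψ₂) (t s : ℝ) :
    HasFDerivAt (fiberMap a b c Ψ₁ Ψ₂)
      ((a * t + c * s - ψ₁ t) • ContinuousLinearMap.fst ℝ ℝ ℝ +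
        (b * s + c * t - ψ₂ s) • ContinuousLinearMap.snd ℝ ℝ ℝ) (t, s) := by
  have e1 : HasFDerivAt (fun p : ℝ × ℝ => p.1) (ContinuousLinearMap.fst ℝ ℝ ℝ) (t, s) :=
    hasFDerivAt_fst
  have e2 : HasFDerivAt (fun p : ℝ × ℝ => p.2) (ContinuousLinearMap.snd ℝ ℝ ℝ) (t, s) :=
    hasFDerivAt_snd
  have d1 := (h₁.hasDerivAt t).comp_hasFDerivAt (f := fun p : ℝ × ℝ => p.1) (t, s) e1
  have d2 := (h₂.hasDerivAt s).comp_hasFDerivAt (f := fun p : ℝ × ℝ => p.2) (t, s) e2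
  have q := ((((e1.pow 2).const_mul a).add ((e2.pow 2).const_mul b)).const_mul (1 / 2)).add
    ((e1.const_mul c).mul e2)
  refine ((q.sub d1).sub d2).congr_fderiv ?_
  ext <;> simp <;> ring

/-- For small `t` the gain `a t²/2` beats the loss `Ψ₁ t ≤ a t²/4`, and the coupling term can only
help. This keeps maximum points off the axes. -/
theorem fiberMap_lt_fst (h₁ : FiberProfile Ψ₁ ψ₁) (ha : 0 < a) (hc : 0 ≤ c) {s : ℝ}
    (hs : 0 ≤ s) : ∃ t, 0 < t ∧ fiberMap a b c Ψ₁ Ψ₂ (0, s) < fiberMap a b c Ψ₁ Ψ₂ (t, s) := by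
  obtain ⟨δ, hδ, h⟩ := h₁.small (a / 4) (by positivity)
  refine ⟨δ / 2, by positivity, ?_⟩
  have h3 := h (δ / 2) (by positivity) (by linarith)
  have h0 := h₁.map_zero
  have : 0 < a / 4 * (δ / 2) ^ 2 := by positivity
  have : 0 ≤ c * (δ / 2) * s := by positivity
  simp only [fiberMap, h0]
  nlinarith

theorem fiberMap_swap (t s : ℝ) :
    fiberMap a b c Ψ₁ Ψ₂ (t, s) = fiberMap b a c Ψ₂ Ψ₁ (s, t) := by
  simp only [fiberMap]; ring

theorem quadratic_bound (h₁ : FiberProfile Ψ₁ ψ₁) (a : ℝ) :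
    ∃ B, 0 ≤ B ∧ ∀ t, 0 ≤ t → a * t ^ 2 - Ψ₁ t ≤ B - t ^ 2 := by
  obtain ⟨R, hR, h⟩ := h₁.large (|a| + 1)
  refine ⟨(|a| + 1) * R ^ 2, by positivity, fun t ht => ?_⟩
  have h1 : a * t ^ 2 ≤ |a| * t ^ 2 := by gcongr; exact le_abs_self a
  rcases le_total R t with hRt | hRt
  · have := h t hRt
    have : 0 ≤ (|a| + 1) * R ^ 2 := by positivity
    linarith
  · have : (|a| + 1) * t ^ 2 ≤ (|a| + 1) * R ^ 2 := by gcongr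
    have := h₁.nonneg t
    linarith

theorem exists_isMax (h₁ : FiberProfile Ψ₁ ψ₁) (h₂ : FiberProfile Ψ₂ ψ₂) (hc : 0 ≤ c) :
    ∃ q ∈ quadrant, ∀ p ∈ quadrant, fiberMap a b c Ψ₁ Ψ₂ p ≤ fiberMap a b c Ψ₁ Ψ₂ q := by
  -- The coupling is absorbed by `c t s ≤ c (t² + s²)/2`, which adds `c/2` to each quadratic
  -- coefficient.
  obtain ⟨B₁, hB₁, hb₁⟩ := h₁.quadratic_bound ((a + c) / 2)
  obtain ⟨B₂, hB₂, hb₂⟩ := h₂.quadratic_bound ((b + c) / 2)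
  have hub : ∀ t s, 0 ≤ t → 0 ≤ s →
      fiberMap a b c Ψ₁ Ψ₂ (t, s) ≤ B₁ + B₂ - t ^ 2 - s ^ 2 := by
    intro t s ht hs
    have := hb₁ t ht
    have := hb₂ s hs
    have : 0 ≤ c * (t - s) ^ 2 := by positivity
    simp only [fiberMap]
    nlinarith
  -- Since `B₁ + B₂ ≤ R²`, the map is nonpositive outside the box `[0, R]²`, hence not above its
  -- value `0` at the origin.
  set R := B₁ + B₂ + 1
  have hR : 0 ≤ R := by positivity
  have hcont : Continuous (fiberMap a b c Ψ₁ Ψ₂) :=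
    continuous_iff_continuousAt.2 fun p =>
      (hasFDerivAt_fiberMap (a := a) (b := b) (c := c) h₁ h₂ p.1 p.2).continuousAt
  have hK : IsCompact (Set.Icc (0 : ℝ) R ×ˢ Set.Icc (0 : ℝ) R) := isCompact_Icc.prod isCompact_Icc
  have h0K : ((0 : ℝ), (0 : ℝ)) ∈ Set.Icc (0 : ℝ) R ×ˢ Set.Icc (0 : ℝ) R := by simp [hR]
  obtain ⟨q, hq, hmax⟩ := hK.exists_isMaxOn ⟨_, h0K⟩ hcont.continuousOn
  refine ⟨q, ⟨hq.1.1, hq.2.1⟩, ?_⟩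
  rintro ⟨t, s⟩ ⟨ht, hs⟩
  simp only [Set.mem_Ici] at ht hs
  by_cases hts : t ≤ R ∧ s ≤ R
  · exact hmax ⟨⟨ht, hts.1⟩, ⟨hs, hts.2⟩⟩
  · have h0 : fiberMap a b c Ψ₁ Ψ₂ (0, 0) = 0 := by
      simp [fiberMap, h₁.map_zero, h₂.map_zero]
    have hq0 := hmax h0K
    simp only [Set.mem_ofPred_eq, h0] at hq0
    refine le_trans (le_trans (hub t s ht hs) ?_) hq0
    rw [not_and_or, not_le, not_le] at hts
    have hRR : B₁ + B₂ ≤ R ^ 2 := by simp only [R]; nlinarith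
    rcases hts with h | h
    · have : R ^ 2 ≤ t ^ 2 := by gcongr
      nlinarith [sq_nonneg s]
    · have : R ^ 2 ≤ s ^ 2 := by gcongr
      nlinarith [sq_nonneg t]

/-- The equations read `ψ₁ t / t = a + c s/t`, and likewise with primes. The hypothesis `hr` says
`s'/t' ≤ s/t`, so `ψ₁ t' / t' ≤ ψ₁ t / t`, and strict monotonicity of `ψ₁ t / t` orders the points.
-/
theorem le_of_crit (h₁ : FiberProfile Ψ₁ ψ₁) (hc : 0 ≤ c) {t s t' s' : ℝ}
    (ht : 0 < t) (ht' : 0 < t') (e : a * t + c * s - ψ₁ t = 0)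
    (e' : a * t' + c * s' - ψ₁ t' = 0) (hr : s' * t ≤ s * t') : t' ≤ t := by
  refine (h₁.strictMono.le_iff_le (Set.mem_Ioi.2 ht') (Set.mem_Ioi.2 ht)).1 ?_
  have e2 : ψ₁ t = a * t + c * s := by linarith
  have e2' : ψ₁ t' = a * t' + c * s' := by linarith
  simp only [e2, e2']
  rw [div_le_div_iff₀ ht' ht]
  nlinarith

/-- If `s'/t' ≤ s/t`, the first equation gives `t' ≤ t` and the second `s ≤ s'`. These inequalities
push the ratio the opposite way, so all of them are equalities. The other case is symmetric. -/
theorem crit_unique (h₁ : FiberProfile Ψ₁ ψ₁) (h₂ : FiberProfile Ψ₂ ψ₂) (hc : 0 ≤ c)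
    {t s t' s' : ℝ} (ht : 0 < t) (ht' : 0 < t') (hs : 0 < s) (hs' : 0 < s')
    (e₁ : a * t + c * s - ψ₁ t = 0) (e₂ : b * s + c * t - ψ₂ s = 0)
    (e₁' : a * t' + c * s' - ψ₁ t' = 0) (e₂' : b * s' + c * t' - ψ₂ s' = 0) :
    t = t' ∧ s = s' := by
  rcases le_total (s' * t) (s * t') with h | h
  · have i1 := h₁.le_of_crit hc ht ht' e₁ e₁' h
    have i2 := h₂.le_of_crit hc hs' hs e₂' e₂ (by linarith)
    constructor <;> nlinarith
  · have i1 := h₁.le_of_crit hc ht' ht e₁' e₁ h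
    have i2 := h₂.le_of_crit hc hs hs' e₂ e₂' (by linarith)
    constructor <;> nlinarith

/-- Divided by `r`, the bracket is `a + c s/r - ψ₁ r / r`, which is strictly decreasing in `r` and
vanishes at `t`. -/
theorem slope_pos (h₁ : FiberProfile Ψ₁ ψ₁) (hc : 0 ≤ c) {t s r : ℝ} (ht : 0 < t) (hs : 0 < s)
    (e : a * t + c * s - ψ₁ t = 0) (hr : 0 < r) (hrt : r < t) :
    0 < (a * r + c * s - ψ₁ r) * r := by
  have h := h₁.strictMono (Set.mem_Ioi.2 hr) (Set.mem_Ioi.2 ht) hrt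
  have e2 : ψ₁ t = a * t + c * s := by linarith
  simp only [e2] at h
  rw [div_lt_div_iff₀ hr ht] at h
  have h5 : c * s * r ≤ c * s * t := by gcongr
  have : 0 < (a * r + c * s - ψ₁ r) * t := by nlinarith
  exact mul_pos (pos_of_mul_pos_left this ht.le) hr

theorem slope_neg (h₁ : FiberProfile Ψ₁ ψ₁) (hc : 0 ≤ c) {t s r : ℝ} (ht : 0 < t) (hs : 0 < s)
    (e : a * t + c * s - ψ₁ t = 0) (hrt : t < r) :
    (a * r + c * s - ψ₁ r) * r < 0 := by
  have hr := ht.trans hrt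
  have h := h₁.strictMono (Set.mem_Ioi.2 ht) (Set.mem_Ioi.2 hr) hrt
  have e2 : ψ₁ t = a * t + c * s := by linarith
  simp only [e2] at h
  rw [div_lt_div_iff₀ ht hr] at h
  have h5 : c * s * t ≤ c * s * r := by gcongr
  have : (a * r + c * s - ψ₁ r) * t < 0 := by nlinarith
  exact mul_neg_of_neg_of_pos (neg_of_mul_neg_left this ht.le) hr

theorem isCritical_iff (h₁ : FiberProfile Ψ₁ ψ₁) (h₂ : FiberProfile Ψ₂ ψ₂) {t s : ℝ}
    (ht : 0 ≤ t) (hs : 0 ≤ s) :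
    IsCritical (fiberMap a b c Ψ₁ Ψ₂) (t, s) ↔
      a * t + c * s - ψ₁ t = 0 ∧ b * s + c * t - ψ₂ s = 0 := by
  have hd := (hasFDerivAt_fiberMap (a := a) (b := b) (c := c) h₁ h₂ t s).hasFDerivWithinAt
    (s := quadrant)
  refine ⟨fun h => ?_, fun ⟨e1, e2⟩ => ?_⟩
  -- Derivatives relative to the quadrant are unique even at boundary points, so the two components
  -- can be read off on the basis vectors.
  · have := (uniqueDiffWithinAt_quadrant (p := (t, s)) ⟨ht, hs⟩).eq hd h
    exact ⟨by simpa using DFunLike.congr_fun this ((1 : ℝ), (0 : ℝ)),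
      by simpa using DFunLike.congr_fun this ((0 : ℝ), (1 : ℝ))⟩
  · simpa [e1, e2, IsCritical] using hd

theorem pos_of_isMax (h₁ : FiberProfile Ψ₁ ψ₁) (h₂ : FiberProfile Ψ₂ ψ₂) (ha : 0 < a) (hb : 0 < b)
    (hc : 0 ≤ c) {t s : ℝ} (hq : (t, s) ∈ quadrant)
    (hmax : ∀ p ∈ quadrant, fiberMap a b c Ψ₁ Ψ₂ p ≤ fiberMap a b c Ψ₁ Ψ₂ (t, s)) :
    0 < t ∧ 0 < s := by
  have ht : 0 ≤ t := hq.1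
  have hs : 0 ≤ s := hq.2
  constructor
  · refine ht.lt_of_ne ?_
    rintro rfl
    obtain ⟨t', ht', hlt⟩ := h₁.fiberMap_lt_fst (b := b) (Ψ₂ := Ψ₂) ha hc hs
    exact absurd (hmax (t', s) ⟨ht'.le, hs⟩) (not_le.2 hlt)
  · refine hs.lt_of_ne ?_
    rintro rfl
    obtain ⟨s', hs', hlt⟩ := h₂.fiberMap_lt_fst (b := a) (Ψ₂ := Ψ₁) hb hc ht
    rw [← fiberMap_swap t 0, ← fiberMap_swap t s'] at hlt
    exact absurd (hmax (t, s') ⟨ht, hs'.le⟩) (not_le.2 hlt)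

theorem crit_of_isMax (h₁ : FiberProfile Ψ₁ ψ₁) (h₂ : FiberProfile Ψ₂ ψ₂) (ha : 0 < a) (hb : 0 < b)
    (hc : 0 ≤ c) {t s : ℝ} (hq : (t, s) ∈ quadrant)
    (hmax : ∀ p ∈ quadrant, fiberMap a b c Ψ₁ Ψ₂ p ≤ fiberMap a b c Ψ₁ Ψ₂ (t, s)) :
    a * t + c * s - ψ₁ t = 0 ∧ b * s + c * t - ψ₂ s = 0 := by
  obtain ⟨ht, hs⟩ := pos_of_isMax h₁ h₂ ha hb hc hq hmax
  have hnhds : quadrant ∈ 𝓝 (t, s) := prod_mem_nhds (Ici_mem_nhds ht) (Ici_mem_nhds hs)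
  have hloc : IsLocalMax (fiberMap a b c Ψ₁ Ψ₂) (t, s) := by
    filter_upwards [hnhds] with p hp using hmax p hp
  have := hloc.hasFDerivAt_eq_zero (hasFDerivAt_fiberMap (a := a) (b := b) (c := c) h₁ h₂ t s)
  exact ⟨by simpa using DFunLike.congr_fun this ((1 : ℝ), (0 : ℝ)),
    by simpa using DFunLike.congr_fun this ((0 : ℝ), (1 : ℝ))⟩

/-- The fibering map has a unique interior critical point and it is the strict global maximum. -/
theorem exists_strict_max (h₁ : FiberProfile Ψ₁ ψ₁) (h₂ : FiberProfile Ψ₂ ψ₂) (ha : 0 < a)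
    (hb : 0 < b) (hc : 0 ≤ c) :
    ∃ t s : ℝ, 0 < t ∧ 0 < s ∧ a * t + c * s - ψ₁ t = 0 ∧ b * s + c * t - ψ₂ s = 0 ∧
      ∀ p ∈ quadrant, p ≠ (t, s) → fiberMap a b c Ψ₁ Ψ₂ p < fiberMap a b c Ψ₁ Ψ₂ (t, s) := by
  obtain ⟨⟨t, s⟩, hq, hmax⟩ := exists_isMax (a := a) (b := b) (c := c) h₁ h₂ hc
  obtain ⟨ht, hs⟩ := pos_of_isMax h₁ h₂ ha hb hc hq hmax
  obtain ⟨e₁, e₂⟩ := crit_of_isMax h₁ h₂ ha hb hc hq hmax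
  refine ⟨t, s, ht, hs, e₁, e₂, ?_⟩
  rintro ⟨t', s'⟩ hp hne
  -- A point with the same value would be another global maximum, hence another interior critical
  -- point.
  refine (hmax _ hp).lt_of_ne fun heq => hne ?_
  have hmax' : ∀ p ∈ quadrant, fiberMap a b c Ψ₁ Ψ₂ p ≤ fiberMap a b c Ψ₁ Ψ₂ (t', s') :=
    fun p hp => heq ▸ hmax p hp
  obtain ⟨ht', hs'⟩ := pos_of_isMax h₁ h₂ ha hb hc hp hmax'
  obtain ⟨e₁', e₂'⟩ := crit_of_isMax h₁ h₂ ha hb hc hp hmax'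
  obtain ⟨rfl, rfl⟩ := crit_unique h₁ h₂ hc ht ht' hs hs' e₁ e₂ e₁' e₂'
  rfl

end FiberProfile

/-! ### Sign, monotonicity and scaling of the nonlinearity -/

theorem eventually_cocompact_real_iff {p : ℝ → Prop} :
    (∀ᶠ t in cocompact ℝ, p t) ↔ ∃ R, ∀ t, R ≤ |t| → p t := by
  rw [← Metric.cobounded_eq_cocompact]
  simpa using (hasBasis_cobounded_norm (E := ℝ)).eventually_iff (q := p)

/-- Sublinear behaviour at the origin together with the monotonicity of `t ↦ f t / |t|`. -/
structure MonotoneNonlinearity (f : ℝ → ℝ) : Prop where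
  continuous : Continuous f
  origin : Tendsto (fun t => f t / |t|) (𝓝[≠] 0) (𝓝 0)
  increasing : StrictMonoOn (fun t => f t / |t|) {0}ᶜ

namespace MonotoneNonlinearity

variable {f : ℝ → ℝ}

theorem map_zero (hf : MonotoneNonlinearity f) : f 0 = 0 := by
  have h1 : Tendsto f (𝓝[≠] 0) (𝓝 (f 0)) := hf.continuous.continuousAt.mono_left inf_le_left
  have h2 : Tendsto (fun t : ℝ => |t|) (𝓝[≠] 0) (𝓝 0) := by
    have : Tendsto (fun t : ℝ => |t|) (𝓝 0) (𝓝 |0|) := continuous_abs.continuousAt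
    rw [abs_zero] at this
    exact this.mono_left inf_le_left
  have h3 := hf.origin.mul h2
  rw [mul_zero] at h3
  refine tendsto_nhds_unique h1 (h3.congr' ?_)
  filter_upwards [self_mem_nhdsWithin] with t ht
  exact div_mul_cancel₀ _ (abs_ne_zero.2 ht)

/-- On the positive axis `f t / |t|` is strictly increasing with limit `0` at the origin. -/
theorem pos_of_pos (hf : MonotoneNonlinearity f) {t : ℝ} (ht : 0 < t) : 0 < f t := by
  have h2 : 0 < t / 2 := by positivity
  have h0 : 0 ≤ f (t / 2) / |t / 2| := by
    refine le_of_tendsto (hf.origin.mono_left (nhdsGT_le_nhdsNE (0 : ℝ))) ?_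
    filter_upwards [Ioo_mem_nhdsGT h2] with s hs
    exact (hf.increasing hs.1.ne' h2.ne' hs.2).le
  have h3 := hf.increasing (show t / 2 ∈ ({0}ᶜ : Set ℝ) from h2.ne')
    (show t ∈ ({0}ᶜ : Set ℝ) from ht.ne') (by linarith)
  have h4 := h0.trans_lt h3
  simp only at h4
  exact (div_pos_iff_of_pos_right (abs_pos.2 ht.ne')).1 h4

theorem neg_of_neg (hf : MonotoneNonlinearity f) {t : ℝ} (ht : t < 0) : f t < 0 := by
  have h2 : t / 2 < 0 := by linarith
  have h0 : f (t / 2) / |t / 2| ≤ 0 := by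
    refine ge_of_tendsto (hf.origin.mono_left (nhdsLT_le_nhdsNE (0 : ℝ))) ?_
    filter_upwards [Ioo_mem_nhdsLT h2] with s hs
    exact (hf.increasing h2.ne hs.2.ne hs.1).le
  have h3 := hf.increasing (show t ∈ ({0}ᶜ : Set ℝ) from ht.ne)
    (show t / 2 ∈ ({0}ᶜ : Set ℝ) from h2.ne) (by linarith)
  have h4 := h3.trans_le h0
  simp only at h4
  rwa [div_lt_iff₀ (abs_pos.2 ht.ne), zero_mul] at h4

theorem mul_self_nonneg (hf : MonotoneNonlinearity f) (t : ℝ) : 0 ≤ f t * t := by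
  rcases lt_trichotomy t 0 with h | rfl | h
  · exact (mul_pos_of_neg_of_neg (hf.neg_of_neg h) h).le
  · simp
  · exact (mul_pos (hf.pos_of_pos h) h).le

/-- Write `f t = (f t / |t|) |t|`. For `t > 0` both factors are positive and increasing; for `t < 0`
the first is negative and increasing while the second decreases. -/
theorem monotone (hf : MonotoneNonlinearity f) : Monotone f := by
  intro a b hab
  rcases hab.eq_or_lt with rfl | hab
  · exact le_rfl
  rcases lt_trichotomy a 0 with ha | rfl | ha
  · rcases lt_trichotomy b 0 with hb | rfl | hb
    · have h := hf.increasing (show a ∈ ({0}ᶜ : Set ℝ) from ha.ne)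
        (show b ∈ ({0}ᶜ : Set ℝ) from hb.ne) hab
      simp only [abs_of_neg ha, abs_of_neg hb] at h
      rw [div_lt_div_iff₀ (by linarith) (by linarith)] at h
      have := hf.neg_of_neg ha
      nlinarith
    · rw [hf.map_zero]; exact (hf.neg_of_neg ha).le
    · exact ((hf.neg_of_neg ha).trans (hf.pos_of_pos hb)).le
  · rw [hf.map_zero]; exact (hf.pos_of_pos hab).le
  · have hb := ha.trans hab
    have h := hf.increasing (show a ∈ ({0}ᶜ : Set ℝ) from ha.ne')
        (show b ∈ ({0}ᶜ : Set ℝ) from hb.ne') hab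
    simp only [abs_of_pos ha, abs_of_pos hb] at h
    rw [div_lt_div_iff₀ ha hb] at h
    have := hf.pos_of_pos ha
    nlinarith

/-- The quotient equals `(f (t v) / |t v|) (|v| v)`. For `v < 0` both the order of the arguments `t
v` and the sign of the multiplier are reversed, so the inequality keeps its direction. -/
theorem slope_lt (hf : MonotoneNonlinearity f) {t₁ t₂ v : ℝ} (h₁ : 0 < t₁) (h : t₁ < t₂)
    (hv : v ≠ 0) : f (t₁ * v) * v / t₁ < f (t₂ * v) * v / t₂ := by
  have h₂ := h₁.trans h
  have e : ∀ t, 0 < t → f (t * v) * v / t = f (t * v) / |t * v| * (|v| * v) := by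
    intro t ht
    have := abs_ne_zero.2 hv
    rw [abs_mul, abs_of_pos ht]
    field_simp
  rw [e _ h₁, e _ h₂]
  have n₁ : t₁ * v ∈ ({0}ᶜ : Set ℝ) := mul_ne_zero h₁.ne' hv
  have n₂ : t₂ * v ∈ ({0}ᶜ : Set ℝ) := mul_ne_zero h₂.ne' hv
  rcases hv.lt_or_gt with hv | hv
  · have := hf.increasing n₂ n₁ (mul_lt_mul_of_neg_right h hv)
    exact mul_lt_mul_of_neg_right this (mul_neg_of_pos_of_neg (abs_pos.2 hv.ne) hv)
  · have := hf.increasing n₁ n₂ (mul_lt_mul_of_pos_right h hv)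
    exact mul_lt_mul_of_pos_right this (mul_pos (abs_pos.2 hv.ne') hv)

theorem tendsto_slope (hf : MonotoneNonlinearity f) (v : ℝ) :
    Tendsto (fun t => f (t * v) * v / t) (𝓝[>] 0) (𝓝 0) := by
  rcases eq_or_ne v 0 with rfl | hv
  · simp
  have h1 : Tendsto (fun t : ℝ => t * v) (𝓝[>] 0) (𝓝[≠] 0) := by
    refine tendsto_nhdsWithin_iff.2 ⟨?_, ?_⟩
    · have : Tendsto (fun t : ℝ => t * v) (𝓝 0) (𝓝 (0 * v)) :=
        (continuous_id.mul continuous_const).tendsto 0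
      rw [zero_mul] at this
      exact this.mono_left inf_le_left
    · filter_upwards [self_mem_nhdsWithin] with t ht
      exact mul_ne_zero (ne_of_gt ht) hv
  have h2 := (hf.origin.comp h1).mul_const (|v| * v)
  rw [zero_mul] at h2
  refine h2.congr' ?_
  filter_upwards [self_mem_nhdsWithin] with t ht
  have ht' : 0 < t := ht
  have := abs_ne_zero.2 hv
  simp only [Function.comp]
  rw [abs_mul, abs_of_pos ht']
  field_simp

theorem hasDerivAt_primF (hf : MonotoneNonlinearity f) (t : ℝ) : HasDerivAt (primF f) (f t) t :=
  intervalIntegral.integral_hasDerivAt_right (hf.continuous.intervalIntegrable _ _)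
    (hf.continuous.stronglyMeasurableAtFilter _ _) hf.continuous.continuousAt

theorem primF_le (hf : MonotoneNonlinearity f) (t : ℝ) : primF f t ≤ f t * t := by
  rcases le_total 0 t with ht | ht
  · have := intervalIntegral.integral_mono_on (μ := volume) ht
      (hf.continuous.intervalIntegrable _ _) (intervalIntegrable_const (c := f t))
      fun x hx => hf.monotone hx.2
    simpa [primF, mul_comm] using this
  · have := intervalIntegral.integral_mono_on (μ := volume) ht (intervalIntegrable_const (c := f t))
      (hf.continuous.intervalIntegrable _ _) fun x hx => hf.monotone hx.1
    rw [primF, intervalIntegral.integral_symm]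
    simp only [intervalIntegral.integral_const, smul_eq_mul] at this
    linarith

theorem primF_nonneg (hf : MonotoneNonlinearity f) (t : ℝ) : 0 ≤ primF f t := by
  rcases le_total 0 t with ht | ht
  · refine intervalIntegral.integral_nonneg ht fun x hx => ?_
    rw [← hf.map_zero]; exact hf.monotone hx.1
  · rw [primF, intervalIntegral.integral_symm, Left.nonneg_neg_iff]
    have := intervalIntegral.integral_mono_on (μ := volume) ht
      (hf.continuous.intervalIntegrable _ _) (intervalIntegrable_const (c := (0 : ℝ)))
      fun x hx => (hf.monotone hx.2).trans_eq hf.map_zero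
    simpa using this

theorem continuous_primF (hf : MonotoneNonlinearity f) : Continuous (primF f) :=
  continuous_iff_continuousAt.2 fun t => (hf.hasDerivAt_primF t).continuousAt

/-- Monotonicity places `f (t v)` between its values at `±T v`; this provides a dominating function
independent of `t`. -/
theorem abs_le_of_abs_le (hf : MonotoneNonlinearity f) {t T v : ℝ} (h : |t| ≤ T) :
    |f (t * v)| ≤ |f (T * v)| + |f (-T * v)| := by
  have h1 := (abs_le.1 h).1
  have h2 := (abs_le.1 h).2
  have p1 := neg_abs_le (f (T * v))
  have p2 := neg_abs_le (f (-T * v))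
  have p3 := le_abs_self (f (T * v))
  have p4 := le_abs_self (f (-T * v))
  have p5 := abs_nonneg (f (T * v))
  have p6 := abs_nonneg (f (-T * v))
  rcases le_total 0 v with hv | hv
  · have q1 := hf.monotone (mul_le_mul_of_nonneg_right h1 hv)
    have q2 := hf.monotone (mul_le_mul_of_nonneg_right h2 hv)
    exact abs_le.2 ⟨by linarith, by linarith⟩
  · have q1 := hf.monotone (mul_le_mul_of_nonpos_right h1 hv)
    have q2 := hf.monotone (mul_le_mul_of_nonpos_right h2 hv)
    exact abs_le.2 ⟨by linarith, by linarith⟩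

end MonotoneNonlinearity

/-! ### The integrals `∫ K F(t v)` as functions of `t` -/

section Fiber

variable {X : Type*} [MeasurableSpace X] {μ : Measure X} {f : ℝ → ℝ} {K v : X → ℝ}

theorem MonotoneNonlinearity.integrable_primF (hf : MonotoneNonlinearity f)
    (hK : AEStronglyMeasurable K μ) (hK0 : ∀ x, 0 < K x) (hv : AEStronglyMeasurable v μ)
    (hint : ∀ T, Integrable (fun x => K x * f (T * v x) * v x) μ) (t : ℝ) :
    Integrable (fun x => K x * primF f (t * v x)) μ := by
  refine ((hint t).const_mul t).mono'
    (hK.mul (hf.continuous_primF.comp_aestronglyMeasurable (hv.const_mul t)))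
    (Eventually.of_forall fun x => ?_)
  rw [Real.norm_of_nonneg (mul_nonneg (hK0 x).le (hf.primF_nonneg _))]
  calc K x * primF f (t * v x) ≤ K x * (f (t * v x) * (t * v x)) := by
        have := hK0 x
        gcongr
        exact hf.primF_le _
    _ = _ := by ring

theorem MonotoneNonlinearity.hasDerivAt_integral_primF (hf : MonotoneNonlinearity f)
    (hK : AEStronglyMeasurable K μ) (hK0 : ∀ x, 0 < K x) (hv : AEStronglyMeasurable v μ)
    (hint : ∀ T, Integrable (fun x => K x * f (T * v x) * v x) μ) (t : ℝ) :
    HasDerivAt (fun t => ∫ x, K x * primF f (t * v x) ∂μ)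
      (∫ x, K x * f (t * v x) * v x ∂μ) t := by
  set T := |t| + 1 with hT
  refine (hasDerivAt_integral_of_dominated_loc_of_deriv_le (Metric.ball_mem_nhds t one_pos)
    (F := fun t x => K x * primF f (t * v x)) (F' := fun t x => K x * f (t * v x) * v x)
    (bound := fun x => ‖K x * f (T * v x) * v x‖ + ‖K x * f (-T * v x) * v x‖)
    (Eventually.of_forall fun s => (hf.integrable_primF hK hK0 hv hint s).aestronglyMeasurable)
    (hf.integrable_primF hK hK0 hv hint t) (hint t).aestronglyMeasurable
    (Eventually.of_forall fun x s hs => ?_) ((hint T).norm.add (hint (-T)).norm)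
    (Eventually.of_forall fun x s _ => ?_)).2
  · have hsT : |s| ≤ T := by
      rw [Metric.mem_ball, Real.dist_eq] at hs
      have := abs_sub_abs_le_abs_sub s t
      linarith
    have := hf.abs_le_of_abs_le (v := v x) hsT
    simp only [norm_mul, Real.norm_eq_abs]
    calc |K x| * |f (s * v x)| * |v x|
        ≤ |K x| * (|f (T * v x)| + |f (-T * v x)|) * |v x| := by gcongr
      _ = _ := by ring
  · have h1 : HasDerivAt (fun s : ℝ => s * v x) (v x) s := by
      simpa using (hasDerivAt_id s).mul_const (v x)
    have h2 := ((hf.hasDerivAt_primF (s * v x)).comp s h1).const_mul (K x)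
    rw [mul_assoc]
    exact h2

/-- The integrands are ordered pointwise by `slope_lt`, strictly wherever `v ≠ 0`. Equal integrals
would force `v = 0` a.e. -/
theorem MonotoneNonlinearity.strictMonoOn_integral (hf : MonotoneNonlinearity f)
    (hK0 : ∀ x, 0 < K x) (hv0 : ¬ v =ᵐ[μ] fun _ => (0 : ℝ))
    (hint : ∀ T, Integrable (fun x => K x * f (T * v x) * v x) μ) :
    StrictMonoOn (fun t => (∫ x, K x * f (t * v x) * v x ∂μ) / t) (Set.Ioi 0) := by
  intro t₁ h₁ t₂ h₂ h
  have h₁' : 0 < t₁ := h₁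
  simp only
  rw [← integral_div, ← integral_div]
  have e : ∀ t x, K x * f (t * v x) * v x / t = K x * (f (t * v x) * v x / t) := by
    intro t x; ring
  have hle : (fun x => K x * f (t₁ * v x) * v x / t₁) ≤ᵐ[μ]
      fun x => K x * f (t₂ * v x) * v x / t₂ := by
    refine Eventually.of_forall fun x => ?_
    simp only [e]
    rcases eq_or_ne (v x) 0 with hx | hx
    · simp [hx]
    · exact mul_le_mul_of_nonneg_left (hf.slope_lt h₁' h hx).le (hK0 x).le
  have i₁ := (hint t₁).div_const t₁
  have i₂ := (hint t₂).div_const t₂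
  refine (integral_mono_ae i₁ i₂ hle).lt_of_ne fun heq => hv0 ?_
  filter_upwards [(integral_eq_iff_of_ae_le i₁ i₂ hle).1 heq] with x hx
  by_contra hne
  simp only [e] at hx
  exact absurd hx (mul_lt_mul_of_pos_left (hf.slope_lt h₁' h hne) (hK0 x)).ne

/-- From `F(τ) ≤ f(τ) τ`, the integral is at most `t² ∫ K f(t v) v / t`. The last integrand tends to
`0` pointwise and, by monotonicity of the slope, is dominated for `t ≤ 1` by its value at `t = 1`.
-/
theorem MonotoneNonlinearity.integral_primF_small (hf : MonotoneNonlinearity f)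
    (hK : AEStronglyMeasurable K μ) (hK0 : ∀ x, 0 < K x) (hv : AEStronglyMeasurable v μ)
    (hint : ∀ T, Integrable (fun x => K x * f (T * v x) * v x) μ) {ε : ℝ} (hε : 0 < ε) :
    ∃ δ > 0, ∀ t, 0 < t → t < δ → ∫ x, K x * primF f (t * v x) ∂μ ≤ ε * t ^ 2 := by
  have key : Tendsto (fun t => ∫ x, K x * (f (t * v x) * v x / t) ∂μ) (𝓝[>] 0) (𝓝 0) := by
    have := tendsto_integral_filter_of_dominated_convergence (μ := μ) (l := 𝓝[>] (0 : ℝ))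
      (F := fun t x => K x * (f (t * v x) * v x / t)) (f := fun _ => (0 : ℝ))
      (fun x => K x * f (1 * v x) * v x) ?_ ?_ (hint 1) ?_
    · simpa using this
    · refine Eventually.of_forall fun t => ?_
      have := ((hint t).div_const t).aestronglyMeasurable
      refine this.congr (Eventually.of_forall fun x => ?_)
      simp only
      ring
    · filter_upwards [Ioc_mem_nhdsGT (zero_lt_one' ℝ)] with t ht
      refine Eventually.of_forall fun x => ?_
      have h0 : 0 ≤ f (t * v x) * v x / t := by
        have e : f (t * v x) * v x / t = f (t * v x) * (t * v x) / t ^ 2 := by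
          have := ht.1.ne'
          field_simp
        rw [e]
        exact div_nonneg (hf.mul_self_nonneg _) (by positivity)
      rw [Real.norm_of_nonneg (mul_nonneg (hK0 x).le h0), mul_assoc]
      refine mul_le_mul_of_nonneg_left ?_ (hK0 x).le
      rcases eq_or_ne (v x) 0 with hx | hx
      · simp [hx]
      rcases ht.2.eq_or_lt with rfl | ht1
      · simp
      · simpa using (hf.slope_lt ht.1 ht1 hx).le
    · refine Eventually.of_forall fun x => ?_
      simpa using (hf.tendsto_slope (v x)).const_mul (K x)
  obtain ⟨δ, hδ, h⟩ := (mem_nhdsGT_iff_exists_Ioo_subset).1 (key.eventually_lt_const hε)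
  refine ⟨δ, hδ, fun t ht htδ => ?_⟩
  have h1 : ∫ x, K x * (f (t * v x) * v x / t) ∂μ < ε := h ⟨ht, htδ⟩
  calc ∫ x, K x * primF f (t * v x) ∂μ
      ≤ ∫ x, t ^ 2 * (K x * (f (t * v x) * v x / t)) ∂μ := by
        have e : ∀ x, t ^ 2 * (K x * (f (t * v x) * v x / t)) =
            t * (K x * f (t * v x) * v x) := by
          intro x
          have := ht.ne'
          field_simp
        simp only [e]
        refine integral_mono (hf.integrable_primF hK hK0 hv hint t) ((hint t).const_mul t)
          fun x => ?_
        simp only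
        have := mul_le_mul_of_nonneg_left (hf.primF_le (t * v x)) (hK0 x).le
        linarith
    _ = t ^ 2 * ∫ x, K x * (f (t * v x) * v x / t) ∂μ := integral_const_mul _ _
    _ ≤ ε * t ^ 2 := by nlinarith [sq_nonneg t]

theorem MonotoneNonlinearity.integral_primF_large (hf : MonotoneNonlinearity f)
    (hsup : Tendsto (fun t => primF f t / |t| ^ 2) (cocompact ℝ) atTop)
    (hK : AEStronglyMeasurable K μ) (hK0 : ∀ x, 0 < K x) (hv : AEStronglyMeasurable v μ)
    (hv0 : ¬ v =ᵐ[μ] fun _ => (0 : ℝ))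
    (hint : ∀ T, Integrable (fun x => K x * f (T * v x) * v x) μ) (M : ℝ) :
    ∃ R, 0 ≤ R ∧ ∀ t, R ≤ t → M * t ^ 2 ≤ ∫ x, K x * primF f (t * v x) ∂μ := by
  have hgrow : ∀ A, ∃ R, 0 < R ∧ ∀ t, R ≤ |t| → A * t ^ 2 ≤ primF f t := by
    intro A
    obtain ⟨R, hR⟩ := eventually_cocompact_real_iff.1 (hsup.eventually_ge_atTop A)
    refine ⟨max R 1, by positivity, fun t ht => ?_⟩
    have h1 := hR t ((le_max_left _ _).trans ht)
    have h2 : 0 < |t| := lt_of_lt_of_le one_pos ((le_max_right _ _).trans ht)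
    rwa [le_div_iff₀ (by positivity), sq_abs] at h1
  -- As `v` is not a.e. zero, some level set `{|v| ≥ δ}` has positive measure; on it the
  -- superquadratic growth of `F` acts uniformly.
  obtain ⟨δ, hδ, hE⟩ : ∃ δ : ℝ, 0 < δ ∧ μ {x | δ ≤ |v x|} ≠ 0 := by
    by_contra! hcon
    refine hv0 ?_
    have : ∀ n : ℕ, ∀ᵐ x ∂μ, |v x| < 1 / ((n : ℝ) + 1) := by
      intro n
      have := measure_eq_zero_iff_ae_notMem.1 (hcon (1 / ((n : ℝ) + 1)) (by positivity))
      filter_upwards [this] with x hx using not_le.1 hx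
    filter_upwards [ae_all_iff.2 this] with x hx
    have := ge_of_tendsto' tendsto_one_div_add_atTop_nhds_zero_nat fun n => (hx n).le
    exact abs_eq_zero.1 (le_antisymm this (abs_nonneg _))
  set E := {x | δ ≤ |v x|} with hE_def
  have hEm : NullMeasurableSet E μ :=
    nullMeasurableSet_le aemeasurable_const (hv.aemeasurable.abs)
  have hlow : ∀ A R : ℝ, 0 ≤ A → (∀ t, R ≤ |t| → A * t ^ 2 ≤ primF f t) → ∀ t, 0 < t → R / δ ≤ t →
      ∀ x ∈ E, A * t ^ 2 * δ ^ 2 * K x ≤ K x * primF f (t * v x) := by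
    intro A R hA hR t ht hRt x hx
    have hx' : δ ≤ |v x| := hx
    rw [div_le_iff₀ hδ] at hRt
    have h1 : R ≤ |t * v x| := by
      rw [abs_mul, abs_of_pos ht]
      exact hRt.trans (by gcongr)
    have h2 := hR _ h1
    have h3 : δ ^ 2 ≤ (v x) ^ 2 := by
      rw [← sq_abs (v x)]; gcongr
    have h4 : A * t ^ 2 * δ ^ 2 ≤ A * (t * v x) ^ 2 := by
      rw [mul_pow, ← mul_assoc]; gcongr
    have := mul_le_mul_of_nonneg_left (h4.trans h2) (hK0 x).le
    linarith
  -- Integrability of `K` on `E` comes from that of `K F(t v)` at `t = R/δ`, where `F(t v)` is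
  -- bounded below on `E` by a positive constant.
  have hKE : IntegrableOn K E μ := by
    obtain ⟨R, hR0, hR⟩ := hgrow 1
    have ht : 0 < R / δ := by positivity
    have hc : 0 < 1 * (R / δ) ^ 2 * δ ^ 2 := by positivity
    refine (((hf.integrable_primF hK hK0 hv hint (R / δ)).integrableOn (s := E)).const_mul
      (1 * (R / δ) ^ 2 * δ ^ 2)⁻¹).mono' hK.restrict ?_
    filter_upwards [ae_restrict_mem₀ hEm] with x hx
    rw [Real.norm_of_nonneg (hK0 x).le, ← div_eq_inv_mul, le_div_iff₀ hc]
    have := hlow 1 R zero_le_one hR (R / δ) ht le_rfl x hx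
    linarith
  have hκ : 0 < ∫ x in E, K x ∂μ := by
    rw [integral_pos_iff_support_of_nonneg (fun x => (hK0 x).le) hKE]
    have : Function.support K = Set.univ := by
      ext x; simp [(hK0 x).ne']
    rw [this, Measure.restrict_apply_univ]
    exact pos_iff_ne_zero.2 hE
  set κ := ∫ x in E, K x ∂μ with hκ_def
  obtain ⟨R, hR0, hR⟩ := hgrow (|M| / (δ ^ 2 * κ))
  refine ⟨R / δ, by positivity, fun t ht => ?_⟩
  have ht0 : 0 < t := lt_of_lt_of_le (by positivity) ht
  have hI := hf.integrable_primF hK hK0 hv hint t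
  calc M * t ^ 2 ≤ |M| * t ^ 2 := by gcongr; exact le_abs_self M
    _ = |M| / (δ ^ 2 * κ) * t ^ 2 * δ ^ 2 * κ := by field_simp
    _ = ∫ x in E, |M| / (δ ^ 2 * κ) * t ^ 2 * δ ^ 2 * K x ∂μ := (integral_const_mul _ _).symm
    _ ≤ ∫ x in E, K x * primF f (t * v x) ∂μ := by
        refine integral_mono_ae (hKE.const_mul _) hI.integrableOn ?_
        filter_upwards [ae_restrict_mem₀ hEm] with x hx
        exact hlow _ R (by positivity) hR t ht0 ht x hx
    _ ≤ ∫ x, K x * primF f (t * v x) ∂μ :=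
        setIntegral_le_integral hI (Eventually.of_forall fun x =>
          mul_nonneg (hK0 x).le (hf.primF_nonneg _))

theorem MonotoneNonlinearity.fiberProfile (hf : MonotoneNonlinearity f)
    (hsup : Tendsto (fun t => primF f t / |t| ^ 2) (cocompact ℝ) atTop)
    (hK : AEStronglyMeasurable K μ) (hK0 : ∀ x, 0 < K x) (hv : AEStronglyMeasurable v μ)
    (hv0 : ¬ v =ᵐ[μ] fun _ => (0 : ℝ))
    (hint : ∀ T, Integrable (fun x => K x * f (T * v x) * v x) μ) :
    FiberProfile (fun t => ∫ x, K x * primF f (t * v x) ∂μ)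
      (fun t => ∫ x, K x * f (t * v x) * v x ∂μ) where
  hasDerivAt := hf.hasDerivAt_integral_primF hK hK0 hv hint
  strictMono := hf.strictMonoOn_integral hK0 hv0 hint
  nonneg t := integral_nonneg fun x => mul_nonneg (hK0 x).le (hf.primF_nonneg _)
  map_zero := by simp [primF]
  small _ hε := hf.integral_primF_small hK hK0 hv hint hε
  large := hf.integral_primF_large hsup hK hK0 hv hv0 hint

end Fiber

/-! ### Growth of the nonlinearity against the weights -/

section Growth

variable {N : ℕ} {α : ℝ} {V K : Rn N → ℝ} {f : ℝ → ℝ}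

theorem growth_of_isBigO {m P : ℝ} (hm : 1 < m) (hf : Continuous f) (hf0 : f 0 = 0)
    (h0 : f =O[𝓝[≠] 0] fun t => |t| ^ (m - 1))
    (hinf : Tendsto (fun t => f t / |t| ^ (P - 1)) (cocompact ℝ) (𝓝 0)) :
    ∃ C, 0 ≤ C ∧ ∀ t, |f t| ≤ C * (|t| ^ (m - 1) + |t| ^ (P - 1)) := by
  obtain ⟨c, hc⟩ := h0.bound
  obtain ⟨δ, hδ, hδc⟩ := Metric.mem_nhdsWithin_iff.1 hc
  have habs : Tendsto (fun t => |f t / |t| ^ (P - 1)|) (cocompact ℝ) (𝓝 0) := by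
    simpa using hinf.abs
  obtain ⟨R, hR⟩ := eventually_cocompact_real_iff.1 (habs.eventually_le_const one_pos)
  obtain ⟨B, hB⟩ := (isCompact_Icc (a := -|R|) (b := |R|)).exists_bound_of_continuousOn
    hf.continuousOn
  have hB0 : 0 ≤ B := (norm_nonneg _).trans (hB 0 (by simp))
  have hd : 0 < δ ^ (m - 1) := by positivity
  -- The three summands serve `|t| < δ`, `|t| ≥ R` and the compact range in between, where `|f| ≤ B`
  -- and `|t| ≥ δ`.
  refine ⟨|c| + 1 + B / δ ^ (m - 1), by positivity, fun t => ?_⟩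
  rcases eq_or_ne t 0 with rfl | ht
  · rw [hf0, abs_zero]; positivity
  have ht' : 0 < |t| := abs_pos.2 ht
  set a := |t| ^ (m - 1) with ha_def
  set b := |t| ^ (P - 1) with hb_def
  have ha : 0 < a := by positivity
  have hb : 0 < b := by positivity
  have hBd : 0 ≤ B / δ ^ (m - 1) := by positivity
  have key : ∀ x, 0 ≤ x → x ≤ |c| + 1 + B / δ ^ (m - 1) → ∀ y, 0 ≤ y → y ≤ a + b →
      |f t| ≤ x * y → |f t| ≤ (|c| + 1 + B / δ ^ (m - 1)) * (a + b) := by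
    intro x hx hx' y hy hy' h
    exact h.trans (by gcongr)
  by_cases h1 : |t| < δ
  · have : ‖f t‖ ≤ c * ‖|t| ^ (m - 1)‖ := hδc ⟨by simpa using h1, ht⟩
    rw [Real.norm_eq_abs, Real.norm_of_nonneg (by positivity)] at this
    refine key |c| (by positivity) (by linarith) a ha.le (by linarith) (this.trans ?_)
    gcongr
    exact le_abs_self c
  by_cases h2 : R ≤ |t|
  · have := hR t h2
    rw [abs_div, abs_of_pos hb, div_le_iff₀ hb] at this
    exact key 1 zero_le_one (by have := abs_nonneg c; linarith) b hb.le (by linarith) this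
  · have h3 : |t| ≤ |R| := (not_le.1 h2).le.trans (le_abs_self R)
    have h4 := hB t (abs_le.1 h3)
    rw [Real.norm_eq_abs] at h4
    refine key (B / δ ^ (m - 1)) hBd (by have := abs_nonneg c; linarith) a ha.le (by linarith)
      (h4.trans ?_)
    rw [div_mul_eq_mul_div, le_div_iff₀ hd]
    have := Real.rpow_le_rpow hδ.le (not_lt.1 h1) (by linarith : 0 ≤ m - 1)
    gcongr

theorem FracSchrodinger.CondH4.exists_bound {m : ℝ} (hV : Continuous V) (hK : Continuous K) (hV0 : ∀ x, 0 < V x)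
    (h : CondH4 α m V K) :
    ∃ C, 0 ≤ C ∧ ∀ x, K x ≤ C * V x ^ ((critExp α N - m) / (critExp α N - 2)) := by
  set θ := (critExp α N - m) / (critExp α N - 2)
  have hcont : Continuous fun x => K x / V x ^ θ :=
    hK.div (hV.rpow_const fun x => Or.inl (hV0 x).ne') fun x =>
      (Real.rpow_pos_of_pos (hV0 x) _).ne'
  obtain ⟨S, hS, hS1⟩ := (hasBasis_cocompact.eventually_iff).1
    (h.2.2.eventually_le_const (zero_lt_one' ℝ))
  obtain ⟨B, hB⟩ := hS.exists_bound_of_continuousOn hcont.continuousOn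
  refine ⟨max B 1, by positivity, fun x => ?_⟩
  rw [← div_le_iff₀ (Real.rpow_pos_of_pos (hV0 x) _)]
  by_cases hx : x ∈ S
  · exact (le_abs_self _).trans ((hB x hx).trans (le_max_left _ _))
  · exact (hS1 hx).trans (le_max_right _ _)

/-- Weighted AM–GM for `a b²` and `b^P` with weight `θ = (P - m)/(P - 2)`, the one for which `m = 2θ
+ P(1 - θ)`. -/
theorem rpow_mul_rpow_le_interpolation {m P a b : ℝ} (hm : 2 < m) (hmP : m < P) (ha : 0 < a)
    (hb : 0 ≤ b) : a ^ ((P - m) / (P - 2)) * b ^ m ≤ a * b ^ 2 + b ^ P := by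
  rcases hb.eq_or_lt with rfl | hb
  · rw [Real.zero_rpow (by linarith), Real.zero_rpow (by linarith)]; simp
  set θ := (P - m) / (P - 2) with hθ
  have hP2 : 0 < P - 2 := by linarith
  have hθ0 : 0 ≤ θ := div_nonneg (by linarith) hP2.le
  have hθ1 : θ ≤ 1 := by rw [hθ, div_le_one hP2]; linarith
  have h := Real.geom_mean_le_arith_mean2_weighted (w₁ := θ) (w₂ := 1 - θ) (p₁ := a * b ^ 2)
    (p₂ := b ^ P) hθ0 (by linarith) (by positivity) (by positivity) (by ring)
  have e : (a * b ^ 2) ^ θ * (b ^ P) ^ (1 - θ) = a ^ θ * b ^ m := by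
    rw [Real.mul_rpow ha.le (by positivity), ← Real.rpow_natCast, ← Real.rpow_mul hb.le,
      ← Real.rpow_mul hb.le, mul_assoc, ← Real.rpow_add hb]
    congr 2
    rw [hθ]
    field_simp
    push_cast
    ring
  rw [e] at h
  have h1 : 0 ≤ a * b ^ 2 := by positivity
  have h2 : 0 ≤ b ^ P := by positivity
  nlinarith

theorem ae_le_of_memLp_top {X : Type*} [MeasurableSpace X] {μ : Measure X} {g : X → ℝ}
    (hg : MemLp g ⊤ μ) : ∃ C, 0 ≤ C ∧ ∀ᵐ x ∂μ, g x ≤ C := by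
  have h := hg.2
  rw [eLpNorm_exponent_top] at h
  refine ⟨(eLpNormEssSup g μ).toReal, ENNReal.toReal_nonneg, ?_⟩
  filter_upwards [ae_le_eLpNormEssSup (f := g) (μ := μ)] with x hx
  have := ENNReal.toReal_mono h.ne hx
  rw [toReal_enorm] at this
  exact (le_abs_self _).trans this

/-- The exceptional null set does not depend on `t`, so the bound may be used at `t = T v(x)`. -/
theorem FracSchrodinger.ClassK.exists_growth (hα0 : 0 < α) (hN : 2 * α < (N : ℝ))
    (hVK : ClassK α V K) (hf : CondF α V K f) (hf0 : f 0 = 0) :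
    ∃ C, 0 ≤ C ∧ ∀ᵐ x, ∀ t, |K x * f t * t| ≤ C * (V x * |t| ^ 2 + |t| ^ critExp α N) := by
  obtain ⟨B, hB0, hB⟩ := ae_le_of_memLp_top hVK.K_bounded
  have hP := two_lt_critExp hα0 hN
  set P := critExp α N with hP_def
  -- Both alternatives take one form: the case of bounded `K / V` is the endpoint `m = 2`, and the
  -- other case follows by interpolation.
  obtain ⟨m, hm, hO, D, hD0, hD⟩ : ∃ m : ℝ, 2 ≤ m ∧ (f =O[𝓝[≠] 0] fun t => |t| ^ (m - 1)) ∧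
      ∃ D, 0 ≤ D ∧ ∀ᵐ x, ∀ t : ℝ, K x * |t| ^ m ≤ D * (V x * |t| ^ 2 + |t| ^ P) := by
    rcases hf.origin with ⟨hA, hlim⟩ | ⟨m, hBm, hO⟩
    · obtain ⟨D, hD0, hD⟩ := ae_le_of_memLp_top hA
      refine ⟨2, le_rfl, ?_, D, hD0, ?_⟩
      · have h1 : (fun t : ℝ => |t| ^ ((2 : ℝ) - 1)) = fun t => |t| := by
          ext t; norm_num
        rw [h1]
        refine (isLittleO_of_tendsto' ?_ hlim).isBigO
        filter_upwards [self_mem_nhdsWithin] with t ht h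
        exact absurd (abs_eq_zero.1 h) ht
      · filter_upwards [hD] with x hx t
        rw [div_le_iff₀ (hVK.V_pos x)] at hx
        have e : |t| ^ (2 : ℝ) = |t| ^ 2 := by norm_cast
        rw [e]
        have h1 : K x * |t| ^ 2 ≤ D * V x * |t| ^ 2 := by gcongr
        have h2 : 0 ≤ D * |t| ^ P := by positivity
        linarith
    · obtain ⟨D, hD0, hD⟩ := hBm.exists_bound hVK.continuous_V hVK.continuous_K hVK.V_pos
      refine ⟨m, hBm.1.le, hO, D, hD0, Eventually.of_forall fun x t => ?_⟩
      have h1 := rpow_mul_rpow_le_interpolation hBm.1 hBm.2.1 (hVK.V_pos x) (abs_nonneg t)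
      calc K x * |t| ^ m ≤ D * V x ^ ((P - m) / (P - 2)) * |t| ^ m := by
            gcongr; exact hD x
        _ = D * (V x ^ ((P - m) / (P - 2)) * |t| ^ m) := by ring
        _ ≤ _ := by gcongr
  obtain ⟨C, hC0, hC⟩ := growth_of_isBigO (P := P) (by linarith) hf.continuous hf0 hO
    hf.quasicritical
  refine ⟨C * (D + B), by positivity, ?_⟩
  filter_upwards [hB, hD] with x hx1 hx2 t
  have hKx := hVK.K_pos x
  have hVx := hVK.V_pos x
  have e : ∀ r : ℝ, r ≠ 0 → |t| ^ (r - 1) * |t| = |t| ^ r := by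
    intro r hr
    rcases eq_or_ne t 0 with rfl | ht
    · simp [Real.zero_rpow hr]
    · rw [Real.rpow_sub_one (abs_ne_zero.2 ht), div_mul_cancel₀ _ (abs_ne_zero.2 ht)]
  have h3 : K x * |t| ^ P ≤ B * (V x * |t| ^ 2 + |t| ^ P) := by
    have : K x * |t| ^ P ≤ B * |t| ^ P := by gcongr
    have : 0 ≤ B * (V x * |t| ^ 2) := by positivity
    linarith
  calc |K x * f t * t| = K x * |f t| * |t| := by
        rw [abs_mul, abs_mul, abs_of_pos hKx]
    _ ≤ K x * (C * (|t| ^ (m - 1) + |t| ^ (P - 1))) * |t| := by gcongr; exact hC t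
    _ = C * (K x * |t| ^ m + K x * |t| ^ P) := by
        rw [← e m (by linarith), ← e P (by linarith)]; ring
    _ ≤ C * (D * (V x * |t| ^ 2 + |t| ^ P) + B * (V x * |t| ^ 2 + |t| ^ P)) := by
        exact mul_le_mul_of_nonneg_left (add_le_add (hx2 t) h3) hC0
    _ = _ := by ring

theorem FracSchrodinger.CondF.monotoneNonlinearity (hf : CondF α V K f) :
    MonotoneNonlinearity f where
  continuous := hf.continuous
  increasing := hf.increasing
  origin := by
    rcases hf.origin with ⟨-, hlim⟩ | ⟨m, hBm, hO⟩
    · exact hlim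
    · obtain ⟨c, hc⟩ := hO.bound
      have hm2 : 0 < m - 2 := by linarith [hBm.1]
      have h1 : Tendsto (fun t : ℝ => |c| * |t| ^ (m - 2)) (𝓝[≠] 0) (𝓝 0) := by
        have h2 : Continuous fun t : ℝ => |c| * |t| ^ (m - 2) :=
          continuous_const.mul (continuous_abs.rpow_const fun _ => Or.inr hm2.le)
        have h3 := h2.tendsto 0
        rw [abs_zero, Real.zero_rpow hm2.ne', mul_zero] at h3
        exact h3.mono_left inf_le_left
      refine squeeze_zero_norm' ?_ h1
      filter_upwards [hc, self_mem_nhdsWithin] with t ht ht0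
      have ht' : 0 < |t| := abs_pos.2 ht0
      rw [norm_div, Real.norm_eq_abs |t|, abs_abs, div_le_iff₀ ht']
      rw [Real.norm_of_nonneg (by positivity : 0 ≤ |t| ^ (m - 1))] at ht
      refine ht.trans ?_
      have e : |t| ^ (m - 2) * |t| = |t| ^ (m - 1) := by
        rw [← Real.rpow_add_one ht'.ne']; congr 1; ring
      rw [mul_assoc, e]
      gcongr
      exact le_abs_self c

theorem FracSchrodinger.ClassK.integrable_nonlinear (hα0 : 0 < α) (hN : 2 * α < (N : ℝ))
    (hVK : ClassK α V K) (hf : CondF α V K f) {v : Rn N → ℝ} (hv : AEStronglyMeasurable v)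
    (hV : Integrable fun x => V x * |v x| ^ 2) (hP : Integrable fun x => |v x| ^ critExp α N)
    (T : ℝ) : Integrable fun x => K x * f (T * v x) * v x := by
  have hf0 := hf.monotoneNonlinearity.map_zero
  rcases eq_or_ne T 0 with rfl | hT
  · simp [hf0]
  obtain ⟨C, hC0, hC⟩ := hVK.exists_growth hα0 hN hf hf0
  have hm : AEStronglyMeasurable fun x => K x * f (T * v x) * v x :=
    (hVK.continuous_K.aestronglyMeasurable.mul
      (hf.continuous.comp_aestronglyMeasurable (hv.const_mul T))).mul hv
  refine ((((hV.const_mul (|T| ^ 2)).add (hP.const_mul (|T| ^ critExp α N))).const_mul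
    (C / |T|))).mono' hm ?_
  filter_upwards [hC] with x hx
  have h1 := hx (T * v x)
  have hT' : 0 < |T| := abs_pos.2 hT
  simp only [Pi.add_apply]
  rw [Real.norm_eq_abs, div_mul_eq_mul_div, le_div_iff₀ hT', ← abs_mul]
  rw [abs_mul T, Real.mul_rpow (abs_nonneg _) (abs_nonneg _), mul_pow] at h1
  calc |K x * f (T * v x) * v x * T| = |K x * f (T * v x) * (T * v x)| := by
        congr 1; ring
    _ ≤ _ := h1
    _ = _ := by ring

end Growth

/-! ### Reduction of the energy on `t u⁺ + s u⁻` to the model -/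

section Nodal

variable {N : ℕ} {α : ℝ} {V K u : Rn N → ℝ} {f : ℝ → ℝ}

theorem pos_eq_comb (u : Rn N → ℝ) : pos u = comb u 1 0 := by
  ext x; simp [comb]

theorem neg_eq_comb (u : Rn N → ℝ) : neg u = comb u 0 1 := by
  ext x; simp [comb]

theorem neg_eq_zero_or_pos_eq_zero (u : Rn N → ℝ) (x : Rn N) : neg u x = 0 ∨ pos u x = 0 := by
  rcases le_total 0 (u x) with h | h
  · exact Or.inl (min_eq_right h)
  · exact Or.inr (max_eq_right h)

theorem pos_part_nonneg (u : Rn N → ℝ) (x : Rn N) : 0 ≤ pos u x := le_max_right _ _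

theorem neg_part_nonpos (u : Rn N → ℝ) (x : Rn N) : neg u x ≤ 0 := min_le_right _ _

theorem pos_comb {t s : ℝ} (ht : 0 ≤ t) (hs : 0 ≤ s) : pos (comb u t s) = fun x => t * pos u x := by
  ext x
  have h1 := mul_nonneg ht (pos_part_nonneg u x)
  have h2 := mul_nonpos_of_nonneg_of_nonpos hs (neg_part_nonpos u x)
  rcases neg_eq_zero_or_pos_eq_zero u x with h | h
  · simp only [comb, pos.eq_1 (comb u t s), h, mul_zero, add_zero]
    exact max_eq_left h1
  · simp only [comb, pos.eq_1 (comb u t s), h, mul_zero, zero_add]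
    exact max_eq_right h2

theorem neg_comb {t s : ℝ} (ht : 0 ≤ t) (hs : 0 ≤ s) : neg (comb u t s) = fun x => s * neg u x := by
  ext x
  have h1 := mul_nonneg ht (pos_part_nonneg u x)
  have h2 := mul_nonpos_of_nonneg_of_nonpos hs (neg_part_nonpos u x)
  rcases neg_eq_zero_or_pos_eq_zero u x with h | h
  · simp only [comb, neg.eq_1 (comb u t s), h, mul_zero, add_zero]
    exact min_eq_right h1
  · simp only [comb, neg.eq_1 (comb u t s), h, mul_zero, zero_add]
    exact min_eq_left h2

theorem comb_mem_spaceX (hα0 : 0 < α) (hα1 : α < 1) (hN : 2 * α < (N : ℝ)) (hV : Continuous V)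
    (hV0 : ∀ x, 0 < V x) (hu : u ∈ spaceX α V) (t s : ℝ) : comb u t s ∈ spaceX α V := by
  have hm := memD_comb hα0 hα1 hN hu.1 t s
  refine ⟨hm, (hu.2.const_mul ((|t| + |s|) ^ 2)).mono' ?_ (Eventually.of_forall fun x => ?_)⟩
  · have h1 := hm.aestronglyMeasurable.aemeasurable
    have h2 := hV.measurable
    have : AEMeasurable fun x => V x * |comb u t s x| ^ 2 := by fun_prop
    exact this.aestronglyMeasurable
  · have h0 := hV0 x
    rw [Real.norm_of_nonneg (by positivity)]
    have h1 : |comb u t s x| ≤ (|t| + |s|) * |u x| := by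
      have := abs_smoothComb_sub_le t s 0 (u x) 0
      rw [comb_eq_smoothComb]
      simpa [smoothComb_zero] using this
    calc V x * |comb u t s x| ^ 2 ≤ V x * ((|t| + |s|) * |u x|) ^ 2 := by gcongr
      _ = _ := by ring

/-- As `u⁺ u⁻ = 0` pointwise, the product of differences is `-u⁺(x) u⁻(y) - u⁺(y) u⁻(x) ≥ 0`. -/
theorem gagliardoForm_pos_neg_nonneg (u : Rn N → ℝ) : 0 ≤ gagliardoForm α (pos u) (neg u) := by
  refine integral_nonneg fun p => div_nonneg ?_ (by positivity)
  have a1 := pos_part_nonneg u p.1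
  have a2 := pos_part_nonneg u p.2
  have b1 := neg_part_nonpos u p.1
  have b2 := neg_part_nonpos u p.2
  have c1 : pos u p.1 * neg u p.1 = 0 := by
    rcases neg_eq_zero_or_pos_eq_zero u p.1 with h | h <;> simp [h]
  have c2 : pos u p.2 * neg u p.2 = 0 := by
    rcases neg_eq_zero_or_pos_eq_zero u p.2 with h | h <;> simp [h]
  have d1 := mul_nonpos_of_nonneg_of_nonpos a1 b2
  have d2 := mul_nonpos_of_nonneg_of_nonpos a2 b1
  nlinarith

/-- The diagonal value `[v]² + ∫ V v²` of the quadratic form of `X`. -/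
noncomputable def quadX (α : ℝ) (V v : Rn N → ℝ) : ℝ :=
  gagliardoForm α v v + ∫ x, V x * |v x| ^ 2

theorem quadX_pos (hV0 : ∀ x, 0 < V x) {v : Rn N → ℝ} (hv : v ∈ spaceX α V) (h0 : Nonzero v) :
    0 < quadX α V v := by
  refine add_pos_of_nonneg_of_pos ?_ ?_
  · exact integral_nonneg fun p => div_nonneg (_root_.mul_self_nonneg _) (by positivity)
  · have hnn : 0 ≤ fun x => V x * |v x| ^ 2 := fun x => by
      have := hV0 x
      simp only [Pi.zero_apply]
      positivity
    refine (integral_nonneg hnn).lt_of_ne fun h => h0 ?_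
    have := (integral_eq_zero_iff_of_nonneg hnn hv.2).1 h.symm
    filter_upwards [this] with x hx
    simpa [(hV0 x).ne'] using hx

theorem dEnergy_const_mul (w φ : Rn N → ℝ) (t : ℝ) :
    dEnergy α V K f w (fun x => t * φ x) = t * dEnergy α V K f w φ := by
  have e1 : gagliardoForm α w (fun x => t * φ x) = t * gagliardoForm α w φ := by
    simp only [gagliardoForm]
    rw [← integral_const_mul]
    congr 1; ext p; ring
  have e2 : ∀ g : Rn N → ℝ, ∫ x, g x * (t * φ x) = t * ∫ x, g x * φ x := by
    intro g
    rw [← integral_const_mul]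
    congr 1; ext x; ring
  simp only [dEnergy]
  rw [e1, e2, e2]
  ring

/-- At each point one of the two parts vanishes, so the potential and nonlinear integrals split
(using `F(0) = 0`). The cross term comes from the nonlocal form alone. -/
theorem hFun_eq_fiberMap (hα0 : 0 < α) (hα1 : α < 1) (hN : 2 * α < (N : ℝ)) (hVK : ClassK α V K)
    (hf : CondF α V K f) (hu : u ∈ spaceX α V) :
    hFun α V K f u = fiberMap (quadX α V (pos u)) (quadX α V (neg u))
      (gagliardoForm α (pos u) (neg u)) (fun t => ∫ x, K x * primF f (t * pos u x))
      (fun t => ∫ x, K x * primF f (t * neg u x)) := by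
  have hm := hf.monotoneNonlinearity
  have mem := comb_mem_spaceX hα0 hα1 hN hVK.continuous_V hVK.V_pos hu
  have hp : pos u ∈ spaceX α V := by rw [pos_eq_comb]; exact mem 1 0
  have hn : neg u ∈ spaceX α V := by rw [neg_eq_comb]; exact mem 0 1
  have gp := hp.1.finiteGagliardo hα0 hα1 hN
  have gn := hn.1.finiteGagliardo hα0 hα1 hN
  have ip := hm.integrable_primF hVK.continuous_K.aestronglyMeasurable hVK.K_pos
    hp.1.aestronglyMeasurable (hVK.integrable_nonlinear hα0 hN hf hp.1.aestronglyMeasurable hp.2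
      (hp.1.integrable_rpow hα0 hα1 hN))
  have iq := hm.integrable_primF hVK.continuous_K.aestronglyMeasurable hVK.K_pos
    hn.1.aestronglyMeasurable (hVK.integrable_nonlinear hα0 hN hf hn.1.aestronglyMeasurable hn.2
      (hn.1.integrable_rpow hα0 hα1 hN))
  have hF0 : primF f 0 = 0 := by simp [primF]
  ext ⟨t, s⟩
  have gc := (mem t s).1.finiteGagliardo hα0 hα1 hN
  have hnorm : normX α V (comb u t s) ^ 2 =
      gagliardoForm α (comb u t s) (comb u t s) + ∫ x, V x * |comb u t s x| ^ 2 := by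
    rw [normX, Real.sq_sqrt, gc.gagliardo_toReal_sq]
    exact add_nonneg (by positivity) (integral_nonneg fun x => mul_nonneg (hVK.V_pos x).le
      (by positivity))
  have hform : gagliardoForm α (comb u t s) (comb u t s) =
      t ^ 2 * gagliardoForm α (pos u) (pos u) + s ^ 2 * gagliardoForm α (neg u) (neg u) +
        2 * t * s * gagliardoForm α (pos u) (neg u) := by
    rw [show comb u t s = fun x => t * pos u x + s * neg u x from rfl] at gc ⊢
    rw [gp.gagliardoForm_lin gn gc, gagliardoForm_comm (pos u), gagliardoForm_comm (neg u),
      gp.gagliardoForm_lin gn gp, gp.gagliardoForm_lin gn gn, gagliardoForm_comm (neg u) (pos u)]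
    ring
  have hint : ∫ x, V x * |comb u t s x| ^ 2 =
      t ^ 2 * (∫ x, V x * |pos u x| ^ 2) + s ^ 2 * ∫ x, V x * |neg u x| ^ 2 := by
    rw [← integral_const_mul, ← integral_const_mul,
      ← integral_add (hp.2.const_mul _) (hn.2.const_mul _)]
    congr 1
    ext x
    simp only [comb, sq_abs]
    rcases neg_eq_zero_or_pos_eq_zero u x with h | h <;> simp only [h] <;> ring
  have hF : ∫ x, K x * primF f (comb u t s x) =
      (∫ x, K x * primF f (t * pos u x)) + ∫ x, K x * primF f (s * neg u x) := by
    rw [← integral_add (ip t) (iq s)]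
    congr 1
    ext x
    simp only [comb]
    rcases neg_eq_zero_or_pos_eq_zero u x with h | h <;> simp [h, hF0]
  simp only [hFun, energy, fiberMap, quadX]
  rw [hnorm, hform, hint, hF]
  ring

theorem Phi1_eq (hα0 : 0 < α) (hα1 : α < 1) (hN : 2 * α < (N : ℝ)) (hVK : ClassK α V K)
    (hu : u ∈ spaceX α V) (t s : ℝ) :
    Phi1 α V K f u t s = quadX α V (pos u) * t + gagliardoForm α (pos u) (neg u) * s -
      ∫ x, K x * f (t * pos u x) * pos u x := by
  have mem := comb_mem_spaceX hα0 hα1 hN hVK.continuous_V hVK.V_pos hu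
  have hp : pos u ∈ spaceX α V := by rw [pos_eq_comb]; exact mem 1 0
  have hn : neg u ∈ spaceX α V := by rw [neg_eq_comb]; exact mem 0 1
  have gp := hp.1.finiteGagliardo hα0 hα1 hN
  have gn := hn.1.finiteGagliardo hα0 hα1 hN
  have h1 : ∫ x, V x * comb u t s x * pos u x = t * ∫ x, V x * |pos u x| ^ 2 := by
    rw [← integral_const_mul]
    congr 1
    ext x
    simp only [comb, sq_abs]
    rcases neg_eq_zero_or_pos_eq_zero u x with h | h <;> simp only [h] <;> ring
  have h2 : ∫ x, K x * f (comb u t s x) * pos u x = ∫ x, K x * f (t * pos u x) * pos u x := by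
    congr 1
    ext x
    simp only [comb]
    rcases neg_eq_zero_or_pos_eq_zero u x with h | h <;> simp [h]
  rw [Phi1, dEnergy, h1, h2, show comb u t s = fun x => t * pos u x + s * neg u x from rfl,
    gp.gagliardoForm_lin gn gp, gagliardoForm_comm (neg u), quadX]
  ring

theorem Phi2_eq (hα0 : 0 < α) (hα1 : α < 1) (hN : 2 * α < (N : ℝ)) (hVK : ClassK α V K)
    (hu : u ∈ spaceX α V) (t s : ℝ) :
    Phi2 α V K f u t s = quadX α V (neg u) * s + gagliardoForm α (pos u) (neg u) * t -
      ∫ x, K x * f (s * neg u x) * neg u x := by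
  have mem := comb_mem_spaceX hα0 hα1 hN hVK.continuous_V hVK.V_pos hu
  have hp : pos u ∈ spaceX α V := by rw [pos_eq_comb]; exact mem 1 0
  have hn : neg u ∈ spaceX α V := by rw [neg_eq_comb]; exact mem 0 1
  have gp := hp.1.finiteGagliardo hα0 hα1 hN
  have gn := hn.1.finiteGagliardo hα0 hα1 hN
  have h1 : ∫ x, V x * comb u t s x * neg u x = s * ∫ x, V x * |neg u x| ^ 2 := by
    rw [← integral_const_mul]
    congr 1
    ext x
    simp only [comb, sq_abs]
    rcases neg_eq_zero_or_pos_eq_zero u x with h | h <;> simp only [h] <;> ring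
  have h2 : ∫ x, K x * f (comb u t s x) * neg u x = ∫ x, K x * f (s * neg u x) * neg u x := by
    congr 1
    ext x
    simp only [comb]
    rcases neg_eq_zero_or_pos_eq_zero u x with h | h <;> simp [h]
  rw [Phi2, dEnergy, h1, h2, show comb u t s = fun x => t * pos u x + s * neg u x from rfl,
    gp.gagliardoForm_lin gn gn, quadX]
  ring

theorem integrable_nonlinear_comb (hα0 : 0 < α) (hα1 : α < 1) (hN : 2 * α < (N : ℝ))
    (hVK : ClassK α V K) (hf : CondF α V K f) (hu : u ∈ spaceX α V) (t s : ℝ) :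
    (Integrable fun x => K x * f (comb u t s x) * pos u x) ∧
      Integrable fun x => K x * f (comb u t s x) * neg u x := by
  have mem := comb_mem_spaceX hα0 hα1 hN hVK.continuous_V hVK.V_pos hu
  have hp : pos u ∈ spaceX α V := by rw [pos_eq_comb]; exact mem 1 0
  have hn : neg u ∈ spaceX α V := by rw [neg_eq_comb]; exact mem 0 1
  constructor
  · refine (hVK.integrable_nonlinear hα0 hN hf hp.1.aestronglyMeasurable hp.2
      (hp.1.integrable_rpow hα0 hα1 hN) t).congr (Eventually.of_forall fun x => ?_)
    simp only [comb]
    rcases neg_eq_zero_or_pos_eq_zero u x with h | h <;> simp [h]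
  · refine (hVK.integrable_nonlinear hα0 hN hf hn.1.aestronglyMeasurable hn.2
      (hn.1.integrable_rpow hα0 hα1 hN) s).congr (Eventually.of_forall fun x => ?_)
    simp only [comb]
    rcases neg_eq_zero_or_pos_eq_zero u x with h | h <;> simp [h]

/-- Shows that the Nehari condition in the definition of `M` follows from the conditions on the two
parts. -/
theorem dEnergy_comb_self (hα0 : 0 < α) (hα1 : α < 1) (hN : 2 * α < (N : ℝ))
    (hVK : ClassK α V K) (hf : CondF α V K f) (hu : u ∈ spaceX α V) (t s : ℝ) :
    dEnergy α V K f (comb u t s) (comb u t s) =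
      t * Phi1 α V K f u t s + s * Phi2 α V K f u t s := by
  have mem := comb_mem_spaceX hα0 hα1 hN hVK.continuous_V hVK.V_pos hu
  have hp : pos u ∈ spaceX α V := by rw [pos_eq_comb]; exact mem 1 0
  have hn : neg u ∈ spaceX α V := by rw [neg_eq_comb]; exact mem 0 1
  have gp := hp.1.finiteGagliardo hα0 hα1 hN
  have gn := hn.1.finiteGagliardo hα0 hα1 hN
  have gc := (mem t s).1.finiteGagliardo hα0 hα1 hN
  obtain ⟨i1, i2⟩ := integrable_nonlinear_comb hα0 hα1 hN hVK hf hu t s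
  have j1 : Integrable fun x => V x * comb u t s x * pos u x := by
    refine (hp.2.const_mul t).congr (Eventually.of_forall fun x => ?_)
    simp only [comb, sq_abs]
    rcases neg_eq_zero_or_pos_eq_zero u x with h | h <;> simp only [h] <;> ring
  have j2 : Integrable fun x => V x * comb u t s x * neg u x := by
    refine (hn.2.const_mul s).congr (Eventually.of_forall fun x => ?_)
    simp only [comb, sq_abs]
    rcases neg_eq_zero_or_pos_eq_zero u x with h | h <;> simp only [h] <;> ring
  have e : ∀ g : Rn N → ℝ, Integrable (fun x => g x * pos u x) →
      Integrable (fun x => g x * neg u x) → ∫ x, g x * comb u t s x =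
        t * (∫ x, g x * pos u x) + s * ∫ x, g x * neg u x := by
    intro g h1 h2
    rw [← integral_const_mul, ← integral_const_mul,
      ← integral_add (h1.const_mul _) (h2.const_mul _)]
    congr 1
    ext x
    simp only [comb]
    ring
  have e1 : gagliardoForm α (comb u t s) (comb u t s) =
      t * gagliardoForm α (comb u t s) (pos u) + s * gagliardoForm α (comb u t s) (neg u) := by
    rw [gagliardoForm_comm _ (pos u), gagliardoForm_comm _ (neg u)]
    exact gp.gagliardoForm_lin gn gc t s
  rw [Phi1, Phi2, dEnergy, dEnergy, dEnergy, e1, e (fun x => V x * comb u t s x) j1 j2,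
    e (fun x => K x * f (comb u t s x)) i1 i2]
  ring

theorem Nonzero.const_mul {v : Rn N → ℝ} (hv : Nonzero v) {t : ℝ} (ht : t ≠ 0) :
    Nonzero fun x => t * v x := by
  intro h
  refine hv ?_
  filter_upwards [h] with x hx
  simpa [ht] using hx

/-- For `t, s ≥ 0` the parts of `t u⁺ + s u⁻` are `t u⁺` and `s u⁻`. Their being nonzero forces `t,
s > 0`, and then the factors `t` and `s` cancel from the pairings. -/
theorem comb_mem_nodal_iff (hα0 : 0 < α) (hα1 : α < 1) (hN : 2 * α < (N : ℝ))
    (hVK : ClassK α V K) (hf : CondF α V K f) (hu : u ∈ spaceX α V) (hpos : Nonzero (pos u))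
    (hneg : Nonzero (neg u)) {t s : ℝ} (ht : 0 ≤ t) (hs : 0 ≤ s) :
    comb u t s ∈ nodal α V K f ↔
      (Phi1 α V K f u t s = 0 ∧ Phi2 α V K f u t s = 0) ∧ 0 < t ∧ 0 < s := by
  have e1 : dEnergy α V K f (comb u t s) (pos (comb u t s)) = t * Phi1 α V K f u t s := by
    rw [pos_comb ht hs, dEnergy_const_mul, Phi1]
  have e2 : dEnergy α V K f (comb u t s) (neg (comb u t s)) = s * Phi2 α V K f u t s := by
    rw [neg_comb ht hs, dEnergy_const_mul, Phi2]
  constructor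
  · rintro ⟨-, h1, h2, h3, h4⟩
    rw [pos_comb ht hs] at h1
    rw [neg_comb ht hs] at h2
    have ht' : t ≠ 0 := by
      rintro rfl
      exact h1 (Eventually.of_forall fun x => by simp)
    have hs' : s ≠ 0 := by
      rintro rfl
      exact h2 (Eventually.of_forall fun x => by simp)
    rw [e1] at h3
    rw [e2] at h4
    exact ⟨⟨(mul_eq_zero.1 h3).resolve_left ht', (mul_eq_zero.1 h4).resolve_left hs'⟩,
      lt_of_le_of_ne ht ht'.symm, lt_of_le_of_ne hs hs'.symm⟩
  · rintro ⟨⟨h1, h2⟩, ht', hs'⟩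
    have hnz : Nonzero (pos (comb u t s)) := by
      rw [pos_comb ht hs]; exact Nonzero.const_mul hpos ht'.ne'
    refine ⟨⟨comb_mem_spaceX hα0 hα1 hN hVK.continuous_V hVK.V_pos hu t s, fun h => hnz ?_, ?_⟩,
      hnz, ?_, ?_, ?_⟩
    · filter_upwards [h] with x hx
      simp [pos, hx]
    · rw [dEnergy_comb_self hα0 hα1 hN hVK hf hu, h1, h2]; simp
    · rw [neg_comb ht hs]; exact Nonzero.const_mul hneg hs'.ne'
    · rw [e1, h1, mul_zero]
    · rw [e2, h2, mul_zero]

theorem fiberProfile_of_mem (hα0 : 0 < α) (hα1 : α < 1) (hN : 2 * α < (N : ℝ))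
    (hVK : ClassK α V K) (hf : CondF α V K f) {v : Rn N → ℝ} (hv : v ∈ spaceX α V)
    (hv0 : Nonzero v) :
    FiberProfile (fun t => ∫ x, K x * primF f (t * v x))
      (fun t => ∫ x, K x * f (t * v x) * v x) :=
  hf.monotoneNonlinearity.fiberProfile hf.superquadratic
    hVK.continuous_K.aestronglyMeasurable hVK.K_pos hv.1.aestronglyMeasurable hv0
    (hVK.integrable_nonlinear hα0 hN hf hv.1.aestronglyMeasurable hv.2
      (hv.1.integrable_rpow hα0 hα1 hN))

end Nodal

/-! ### The theorem -/

theorem lemma4p1 (N : ℕ) (α : ℝ) (hα0 : 0 < α) (hα1 : α < 1) (hN : 2 * α < (N : ℝ))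
    (V K : Rn N → ℝ) (hVK : ClassK α V K) (f : ℝ → ℝ) (hf : CondF α V K f)
    (u : Rn N → ℝ) (hu : u ∈ spaceX α V) (hpos : Nonzero (pos u)) (hneg : Nonzero (neg u)) :
    -- the gradient of `h^u` on the quadrant is `(Φ₁^u, Φ₂^u)`
    (∀ t s : ℝ, 0 ≤ t → 0 ≤ s →
      HasFDerivWithinAt (hFun α V K f u)
        (Phi1 α V K f u t s • ContinuousLinearMap.fst ℝ ℝ ℝ +
          Phi2 α V K f u t s • ContinuousLinearMap.snd ℝ ℝ ℝ) quadrant (t, s)) ∧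
    -- (i)
    (∀ t s : ℝ, 0 ≤ t → 0 ≤ s →
      ((IsCritical (hFun α V K f u) (t, s) ∧ 0 < t ∧ 0 < s) ↔
        comb u t s ∈ nodal α V K f)) ∧
    ∃ tp sm : ℝ, 0 < tp ∧ 0 < sm ∧
      -- (ii)
      IsCritical (hFun α V K f u) (tp, sm) ∧
      (∀ t s : ℝ, 0 < t → 0 < s → IsCritical (hFun α V K f u) (t, s) → t = tp ∧ s = sm) ∧
      (∀ p ∈ quadrant, p ≠ (tp, sm) → hFun α V K f u p < hFun α V K f u (tp, sm)) ∧
      -- (iii)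
      (∀ r : ℝ, 0 < r → r < tp → 0 < Phi1 α V K f u r sm * r) ∧
      (∀ r : ℝ, tp < r → Phi1 α V K f u r sm * r < 0) ∧
      (∀ r : ℝ, 0 < r → r < sm → 0 < Phi2 α V K f u tp r * r) ∧
      (∀ r : ℝ, sm < r → Phi2 α V K f u tp r * r < 0) := by
  have mem := comb_mem_spaceX hα0 hα1 hN hVK.continuous_V hVK.V_pos hu
  have hp : pos u ∈ spaceX α V := by rw [pos_eq_comb]; exact mem 1 0
  have hn : neg u ∈ spaceX α V := by rw [neg_eq_comb]; exact mem 0 1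
  have P₁ := fiberProfile_of_mem hα0 hα1 hN hVK hf hp hpos
  have P₂ := fiberProfile_of_mem hα0 hα1 hN hVK hf hn hneg
  have ha := quadX_pos hVK.V_pos hp hpos
  have hb := quadX_pos hVK.V_pos hn hneg
  have hc := gagliardoForm_pos_neg_nonneg (α := α) u
  have hΦ₁ := Phi1_eq (f := f) hα0 hα1 hN hVK hu
  have hΦ₂ := Phi2_eq (f := f) hα0 hα1 hN hVK hu
  have hcrit : ∀ t s : ℝ, 0 ≤ t → 0 ≤ s → (IsCritical (hFun α V K f u) (t, s) ↔
      Phi1 α V K f u t s = 0 ∧ Phi2 α V K f u t s = 0) := by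
    intro t s ht hs
    rw [hFun_eq_fiberMap hα0 hα1 hN hVK hf hu, P₁.isCritical_iff P₂ ht hs, hΦ₁, hΦ₂]
  refine ⟨fun t s _ _ => ?_, fun t s ht hs => ?_, ?_⟩
  · rw [hFun_eq_fiberMap hα0 hα1 hN hVK hf hu, hΦ₁, hΦ₂]
    exact (P₁.hasFDerivAt_fiberMap P₂ t s).hasFDerivWithinAt
  · rw [comb_mem_nodal_iff hα0 hα1 hN hVK hf hu hpos hneg ht hs, hcrit t s ht hs]
  · obtain ⟨tp, sm, htp, hsm, e₁, e₂, hmax⟩ := P₁.exists_strict_max P₂ ha hb hc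
    refine ⟨tp, sm, htp, hsm, ?_, ?_, ?_, ?_, ?_, ?_, ?_⟩
    · rw [hcrit tp sm htp.le hsm.le, hΦ₁, hΦ₂]
      exact ⟨e₁, e₂⟩
    · intro t s ht hs h
      rw [hcrit t s ht.le hs.le, hΦ₁, hΦ₂] at h
      exact P₁.crit_unique P₂ hc ht htp hs hsm h.1 h.2 e₁ e₂
    · rw [hFun_eq_fiberMap hα0 hα1 hN hVK hf hu]
      exact hmax
    · intro r hr hrt
      rw [hΦ₁]
      exact P₁.slope_pos hc htp hsm e₁ hr hrt
    · intro r hrt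
      rw [hΦ₁]
      exact P₁.slope_neg hc htp hsm e₁ hrt
    · intro r hr hrs
      rw [hΦ₂]
      exact P₂.slope_pos hc hsm htp e₂ hr hrs
    · intro r hrs
      rw [hΦ₂]
      exact P₂.slope_neg hc hsm htp e₂ hrs
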